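/- Let $a>0$, $b\in\mathbb R$ and $$\Phi(x,y)=\bigl(x+e^{ay+b}\bigr)\exp\Bigl(-\frac{x^2}{2}-\frac{a y^2}{2}\Bigr),\qquad (x,y)\in\mathbb R^2,\qquad F=\log\Phi\ \text{ (where }\Phi>0).$$ Suppose that $\Phi$ has a unique global maximum point $(x_*,y_*)$ on $\mathbb R^2$ and that the Hessian matrix $\mathrm{Hess}\,F(x_*,y_*)$ is negative definite. For $H=F$ or $H=G$ write $H_{i,j}=\frac{\partial^{i+j}H}{\partial x^i\partial y^j}(x_*,y_*)$, and set $$C=\bigl(-\mathrm{Hess}\,F(x_*,y_*)\bigr)^{-1},\qquad D=\det\bigl(-\mathrm{Hess}\,F(x_*,y_*)\bigr)=F_{2,0}F_{0,2}-F_{1,1}^2 .$$ Let $\mathcal G_{i,j}$ be the moment $\mathbb E[X^iY^j]$ of the centred Gaussian vector with covariance matrix $D\,C=\begin{pmatrix}-F_{0,2}&F_{1,1}\\F_{1,1}&-F_{2,0}\end{pmatrix}$, that is, $$\mathcal G_{i,j}=\frac{1}{2\pi\sqrt D}\iint_{\mathbb R^2}x^iy^j\exp\Bigl(-\tfrac12(x,y)(D\,C)^{-1}(x,y)^T\Bigr)\,dx\,dy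 .$$ For a function $G:\mathbb R^2\to\mathbb R$ that is real analytic in a neighbourhood of $(x_*,y_*)$ and such that $\Phi^N G$ is integrable on $\mathbb R^2$ for all sufficiently large $N\in\mathbb N$, set $$I_N(G)=\iint_{\mathbb R^2}\Phi(x,y)^N\,G(x,y)\,dx\,dy,\qquad I_N'(G)=I_N(G)\Big/\Bigl(\frac{2\pi}{N\sqrt D}\,e^{N F(x_*,y_*)}\Bigr).$$ Then, as $N\to\infty$: a) $I_N'(G)=G(x_*,y_*)+O(N^{-1})$. b) If $G\equiv1$, then $I_N'(G)=1+\mathcal L\,N^{-1}+O(N^{-2})$, where $\mathcal L=\mathcal L^{(1)}+\mathcal L^{(2)}$, $$\mathcal L^{(1)}=\sum_{i+j=4}\frac{F_{i,j}}{i!j!}\frac{\mathcal G_{i,j}}{D^2},\qquad \mathcal L^{(2)}=\frac12\sum_{\substack{i_1+j_1=3\\ i_2+j_2=3}}\frac{F_{i_1,j_1}}{i_1!j_1!}\frac{F_{i_2,j_2}}{i_2!j_2!}\frac{\mathcal G_{i_1+i_2,j_1+j_2}}{D^3}.$$ c) If $G(x_*,y_*)=0$, then $I_N'(G)=\mathcal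 K_G\,N^{-1}+O(N^{-2})$, where $\mathcal K_G=\mathcal K_G^{(1)}+\mathcal K_G^{(2)}$, $$\mathcal K_G^{(1)}=\sum_{i+j=2}\frac{G_{i,j}}{i!j!}\frac{\mathcal G_{i,j}}{D},\qquad \mathcal K_G^{(2)}=\sum_{\substack{i_1+j_1=3\\ i_2+j_2=1}}\frac{F_{i_1,j_1}}{i_1!j_1!}\frac{G_{i_2,j_2}}{i_2!j_2!}\frac{\mathcal G_{i_1+i_2,j_1+j_2}}{D^2}.$$ d) If $G(x_*,y_*)=0$ and $\nabla G(x_*,y_*)=0$, then $I_N'(G)=\mathcal K_G^{(1)}N^{-1}+\mathcal M_G\,N^{-2}+O(N^{-3})$, where $\mathcal M_G=\mathcal M_G^{(1)}+\mathcal M_G^{(2)}+\mathcal M_G^{(3)}+\mathcal M_G^{(4)}$, $$\mathcal M_G^{(1)}=\sum_{i+j=4}\frac{G_{i,j}}{i!j!}\frac{\mathcal G_{i,j}}{D^2},\qquad \mathcal M_G^{(2)}=\sum_{\substack{i_1+j_1=3\\ i_2+j_2=3}}\frac{F_{i_1,j_1}}{i_1!j_1!}\frac{G_{i_2,j_2}}{i_2!j_2!}\frac{\mathcal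 G_{i_1+i_2,j_1+j_2}}{D^3},$$ $$\mathcal M_G^{(3)}=\sum_{\substack{i_1+j_1=4\\ i_2+j_2=2}}\frac{F_{i_1,j_1}}{i_1!j_1!}\frac{G_{i_2,j_2}}{i_2!j_2!}\frac{\mathcal G_{i_1+i_2,j_1+j_2}}{D^3},$$ $$\mathcal M_G^{(4)}=\frac12\sum_{\substack{i_1+j_1=3\\ i_2+j_2=3\\ i_3+j_3=2}}\frac{F_{i_1,j_1}}{i_1!j_1!}\frac{F_{i_2,j_2}}{i_2!j_2!}\frac{G_{i_3,j_3}}{i_3!j_3!}\frac{\mathcal G_{i_1+i_2+i_3,j_1+j_2+j_3}}{D^4}.$$ All sums run over non-negative integers (ordered tuples), and the implied constants may depend on $a,b,G$ but not on $N$. -/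

import Mathlib

open Real Filter Asymptotics MeasureTheory Finset Matrix

noncomputable section

namespace MonomerDimer

/-- The function `Φ(x,y) = (x + e^{ay+b}) exp(-x²/2 - a y²/2)` on the plane. -/
def Phi (a b : ℝ) (p : ℝ × ℝ) : ℝ :=
  (p.1 + exp (a * p.2 + b)) * exp (-(p.1 ^ 2) / 2 - a * p.2 ^ 2 / 2)

/-- `F = log Φ` (meaningful where `Φ > 0`, in particular for `x, y > 0`). -/
def F (a b : ℝ) (p : ℝ × ℝ) : ℝ := log (Phi a b p)

/-- `p` is the unique global maximum point of `f` on the plane. -/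
def IsUniqueGlobalMax (f : ℝ × ℝ → ℝ) (p : ℝ × ℝ) : Prop :=
  (∀ q, f q ≤ f p) ∧ ∀ p', (∀ q, f q ≤ f p') → p' = p

/-- The partial derivative `∂^{i+j} f / ∂x^i ∂y^j` at the point `p`. -/
def pderiv (f : ℝ × ℝ → ℝ) (p : ℝ × ℝ) (i j : ℕ) : ℝ :=
  iteratedDeriv i (fun x => iteratedDeriv j (fun y => f (x, y)) p.2) p.1

/-- The Taylor coefficient `f_{i,j} / (i! j!)` of `f` at the point `p`. -/
def coef (f : ℝ × ℝ → ℝ) (p : ℝ × ℝ) (i j : ℕ) : ℝ :=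
  pderiv f p i j / ((i.factorial : ℝ) * (j.factorial : ℝ))

/-- The Hessian matrix of `f` at `p`. -/
def hess (f : ℝ × ℝ → ℝ) (p : ℝ × ℝ) : Matrix (Fin 2) (Fin 2) ℝ :=
  !![pderiv f p 2 0, pderiv f p 1 1; pderiv f p 1 1, pderiv f p 0 2]

/-- The matrix `C = (-Hess F)⁻¹`. -/
def C (a b : ℝ) (p : ℝ × ℝ) : Matrix (Fin 2) (Fin 2) ℝ := (-hess (F a b) p)⁻¹

/-- The determinant `D = det (-Hess F)`. -/
def D (a b : ℝ) (p : ℝ × ℝ) : ℝ := (-hess (F a b) p).det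

/-- The moment `E[X^i Y^j]` of a centred Gaussian vector `(X, Y)` in the plane with
(nondegenerate) covariance matrix `S`. -/
def gaussMoment (S : Matrix (Fin 2) (Fin 2) ℝ) (i j : ℕ) : ℝ :=
  1 / (2 * π * √S.det) *
    ∫ q : ℝ × ℝ, q.1 ^ i * q.2 ^ j *
      exp (-(1 / 2) * (![q.1, q.2] ⬝ᵥ (S⁻¹ *ᵥ ![q.1, q.2])))

/-- The Gaussian moments `𝒢_{i,j}`, normalised so that `𝒢_{i,j} / D^{(i+j)/2}` is the moment
`E[X^i Y^j]` of the centred Gaussian vector with covariance matrix `C`; equivalently, they are the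
moments of the centred Gaussian vector with covariance matrix
`D C = !![-F_{0,2}, F_{1,1}; F_{1,1}, -F_{2,0}]`. -/
def gau (a b : ℝ) (p : ℝ × ℝ) (i j : ℕ) : ℝ := gaussMoment (D a b p • C a b p) i j

/-- The integral `I_N(G) = ∬ Φ^N G`. -/
def I (a b : ℝ) (G : ℝ × ℝ → ℝ) (N : ℕ) : ℝ := ∫ q : ℝ × ℝ, Phi a b q ^ N * G q

/-- The normalised integral `I_N'(G) = I_N(G) / ((2π / (N √D)) e^{N F(p)})`. -/
def I' (a b : ℝ) (p : ℝ × ℝ) (G : ℝ × ℝ → ℝ) (N : ℕ) : ℝ :=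
  I a b G N / (2 * π / (N * √(D a b p)) * exp (N * F a b p))

def L1 (a b : ℝ) (p : ℝ × ℝ) : ℝ :=
  ∑ k ∈ antidiagonal 4, coef (F a b) p k.1 k.2 * (gau a b p k.1 k.2 / D a b p ^ 2)

def L2 (a b : ℝ) (p : ℝ × ℝ) : ℝ :=
  1 / 2 * ∑ k ∈ antidiagonal 3, ∑ l ∈ antidiagonal 3,
    coef (F a b) p k.1 k.2 * coef (F a b) p l.1 l.2 *
      (gau a b p (k.1 + l.1) (k.2 + l.2) / D a b p ^ 3)

/-- The coefficient `𝓛`. -/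
def L (a b : ℝ) (p : ℝ × ℝ) : ℝ := L1 a b p + L2 a b p

/-- The coefficient `𝒦⁽¹⁾_G`. -/
def K1 (a b : ℝ) (p : ℝ × ℝ) (G : ℝ × ℝ → ℝ) : ℝ :=
  ∑ k ∈ antidiagonal 2, coef G p k.1 k.2 * (gau a b p k.1 k.2 / D a b p)

def K2 (a b : ℝ) (p : ℝ × ℝ) (G : ℝ × ℝ → ℝ) : ℝ :=
  ∑ k ∈ antidiagonal 3, ∑ l ∈ antidiagonal 1,
    coef (F a b) p k.1 k.2 * coef G p l.1 l.2 *
      (gau a b p (k.1 + l.1) (k.2 + l.2) / D a b p ^ 2)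

/-- The coefficient `𝒦_G`. -/
def K (a b : ℝ) (p : ℝ × ℝ) (G : ℝ × ℝ → ℝ) : ℝ := K1 a b p G + K2 a b p G

def M1 (a b : ℝ) (p : ℝ × ℝ) (G : ℝ × ℝ → ℝ) : ℝ :=
  ∑ k ∈ antidiagonal 4, coef G p k.1 k.2 * (gau a b p k.1 k.2 / D a b p ^ 2)

def M2 (a b : ℝ) (p : ℝ × ℝ) (G : ℝ × ℝ → ℝ) : ℝ :=
  ∑ k ∈ antidiagonal 3, ∑ l ∈ antidiagonal 3,
    coef (F a b) p k.1 k.2 * coef G p l.1 l.2 *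
      (gau a b p (k.1 + l.1) (k.2 + l.2) / D a b p ^ 3)

def M3 (a b : ℝ) (p : ℝ × ℝ) (G : ℝ × ℝ → ℝ) : ℝ :=
  ∑ k ∈ antidiagonal 4, ∑ l ∈ antidiagonal 2,
    coef (F a b) p k.1 k.2 * coef G p l.1 l.2 *
      (gau a b p (k.1 + l.1) (k.2 + l.2) / D a b p ^ 3)

def M4 (a b : ℝ) (p : ℝ × ℝ) (G : ℝ × ℝ → ℝ) : ℝ :=
  1 / 2 * ∑ k ∈ antidiagonal 3, ∑ l ∈ antidiagonal 3, ∑ m ∈ antidiagonal 2,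
    coef (F a b) p k.1 k.2 * coef (F a b) p l.1 l.2 * coef G p m.1 m.2 *
      (gau a b p (k.1 + l.1 + m.1) (k.2 + l.2 + m.2) / D a b p ^ 4)

/-- The coefficient `𝓜_G`. -/
def M (a b : ℝ) (p : ℝ × ℝ) (G : ℝ × ℝ → ℝ) : ℝ :=
  M1 a b p G + M2 a b p G + M3 a b p G + M4 a b p G

end MonomerDimer

end

/-!
The proof is Laplace's method. Put `ε = N^(-1/2)` and `q = p + ε u`. Near the maximum point `p`,
where the gradient of `F` vanishes, Taylor's formula (`taylor_isBigO`) gives `N (F(p + ε u) -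
F(p)) = -Q(u) + ρ`, with `Q(u) = ½ uᵀ (-Hess F(p)) u` and `ρ = ε c₃(u) + ε² c₄(u) + ε³ c₅(u) +
O(ε⁴)`, where `cₖ` is the homogeneous Taylor part of degree `k`. On a small ball `|ρ| ≤ Q / 2`,
so that `exp ρ` can be replaced by its cubic Taylor polynomial at the cost of half of the
Gaussian decay (`exists_abs_exp_mul_sub_le`).

If the Taylor expansion of `G` at `p` starts in degree `s`, then `ε⁻ˢ G(p + ε u)` has an
expansion of the same kind, and the product of the two expansions is integrated against `exp
(-Q)`. The coefficient of `εᵏ` in the product has the parity of `k + s`; for even `s` the odd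
orders drop out, and what is left is an expansion in powers of `1 / N` with two explicit terms
(`exists_abs_integral_sub_gaussAvg_le`, `laplace_expansion`).

Away from `p` the integrand is exponentially small relative to `Φ(p)^N` (`exists_abs_tail_le`):
`Φ` decays at infinity, and where it is negative `|Φ|` is smaller than the value of `Φ` at the
point reflected in the `y`-axis.

The case `s = 0` (`laplace_expansion_of_zero`) gives `I'_N(G) = G(p) + (𝒦_G + G(p) 𝓛) / N +
O(N⁻²)`, which contains the first three claims; the case `s = 2` is the last one. Multiplying
out the homogeneous Taylor parts identifies the Gaussian expectations with the sums that define
`𝓛`, `𝒦_G` and `𝓜_G` (`peakAvg_taylorHom` and its variants for products).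
-/

namespace MonomerDimer

open scoped Topology

/-! ### Taylor's formula in two variables -/

/-- The partial derivative `∂f/∂x`, as a one-variable derivative. With this choice
`pderiv` is an iterate of `partialX` and `partialY` without any regularity of `f`. -/
noncomputable def partialX (f : ℝ × ℝ → ℝ) (q : ℝ × ℝ) : ℝ := deriv (fun x => f (x, q.2)) q.1

/-- The partial derivative `∂f/∂y`, as a one-variable derivative. -/
noncomputable def partialY (f : ℝ × ℝ → ℝ) (q : ℝ × ℝ) : ℝ := deriv (fun y => f (q.1, y)) q.2

lemma iteratedDeriv_snd (f : ℝ × ℝ → ℝ) (j : ℕ) (x y : ℝ) :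
    iteratedDeriv j (fun y => f (x, y)) y = (partialY^[j] f) (x, y) := by
  induction j generalizing y with
  | zero => simp
  | succ n ih =>
    rw [iteratedDeriv_succ, Function.iterate_succ_apply', partialY]
    congr 1
    funext t
    exact ih t

lemma iteratedDeriv_fst (f : ℝ × ℝ → ℝ) (i : ℕ) (x y : ℝ) :
    iteratedDeriv i (fun x => f (x, y)) x = (partialX^[i] f) (x, y) := by
  induction i generalizing x with
  | zero => simp
  | succ n ih =>
    rw [iteratedDeriv_succ, Function.iterate_succ_apply', partialX]
    congr 1
    funext t
    exact ih t

lemma pderiv_eq_iterate (f : ℝ × ℝ → ℝ) (p : ℝ × ℝ) (i j : ℕ) :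
    pderiv f p i j = (partialX^[i] (partialY^[j] f)) p := by
  simp only [pderiv, iteratedDeriv_snd, iteratedDeriv_fst]

lemma partialX_eq_fderiv {f : ℝ × ℝ → ℝ} {q : ℝ × ℝ} (hf : DifferentiableAt ℝ f q) :
    partialX f q = fderiv ℝ f q (1, 0) := by
  have h1 : HasDerivAt (fun x : ℝ => (x, q.2)) ((1 : ℝ), (0 : ℝ)) q.1 :=
    (hasDerivAt_id q.1).prodMk (hasDerivAt_const q.1 q.2)
  exact (hf.hasFDerivAt.comp_hasDerivAt q.1 h1).deriv

lemma partialY_eq_fderiv {f : ℝ × ℝ → ℝ} {q : ℝ × ℝ} (hf : DifferentiableAt ℝ f q) :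
    partialY f q = fderiv ℝ f q (0, 1) := by
  have h1 : HasDerivAt (fun y : ℝ => (q.1, y)) ((0 : ℝ), (1 : ℝ)) q.2 :=
    (hasDerivAt_const q.2 q.1).prodMk (hasDerivAt_id q.2)
  exact (hf.hasFDerivAt.comp_hasDerivAt q.2 h1).deriv

lemma partialX_eventuallyEq {f : ℝ × ℝ → ℝ} {p : ℝ × ℝ} (hf : AnalyticAt ℝ f p) :
    partialX f =ᶠ[𝓝 p] fun q => fderiv ℝ f q (1, 0) := by
  filter_upwards [hf.eventually_analyticAt] with q hq
  exact partialX_eq_fderiv hq.differentiableAt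

lemma partialY_eventuallyEq {f : ℝ × ℝ → ℝ} {p : ℝ × ℝ} (hf : AnalyticAt ℝ f p) :
    partialY f =ᶠ[𝓝 p] fun q => fderiv ℝ f q (0, 1) := by
  filter_upwards [hf.eventually_analyticAt] with q hq
  exact partialY_eq_fderiv hq.differentiableAt

lemma analyticAt_fderiv_apply {f : ℝ × ℝ → ℝ} {p : ℝ × ℝ} (hf : AnalyticAt ℝ f p) (v : ℝ × ℝ) :
    AnalyticAt ℝ (fun q => fderiv ℝ f q v) p :=
  (ContinuousLinearMap.apply ℝ ℝ v).analyticAt _ |>.comp hf.fderiv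

lemma analyticAt_partialX {f : ℝ × ℝ → ℝ} {p : ℝ × ℝ} (hf : AnalyticAt ℝ f p) :
    AnalyticAt ℝ (partialX f) p :=
  (analyticAt_fderiv_apply hf (1, 0)).congr (partialX_eventuallyEq hf).symm

lemma analyticAt_partialY {f : ℝ × ℝ → ℝ} {p : ℝ × ℝ} (hf : AnalyticAt ℝ f p) :
    AnalyticAt ℝ (partialY f) p :=
  (analyticAt_fderiv_apply hf (0, 1)).congr (partialY_eventuallyEq hf).symm

lemma partialX_congr {f g : ℝ × ℝ → ℝ} {p : ℝ × ℝ} (h : f =ᶠ[𝓝 p] g) :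
    partialX f =ᶠ[𝓝 p] partialX g := by
  filter_upwards [h.eventually_nhds] with q hq
  have hc : ContinuousAt (fun x : ℝ => (x, q.2)) q.1 := by fun_prop
  exact Filter.EventuallyEq.deriv_eq (hc.eventually hq)

lemma partialY_congr {f g : ℝ × ℝ → ℝ} {p : ℝ × ℝ} (h : f =ᶠ[𝓝 p] g) :
    partialY f =ᶠ[𝓝 p] partialY g := by
  filter_upwards [h.eventually_nhds] with q hq
  have hc : ContinuousAt (fun y : ℝ => (q.1, y)) q.2 := by fun_prop
  exact Filter.EventuallyEq.deriv_eq (hc.eventually hq)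

lemma fderiv_fderiv_apply {f : ℝ × ℝ → ℝ} {p : ℝ × ℝ} (hf : AnalyticAt ℝ f p) (v w : ℝ × ℝ) :
    fderiv ℝ (fun q => fderiv ℝ f q v) p w = fderiv ℝ (fderiv ℝ f) p w v := by
  rw [fderiv_clm_apply hf.fderiv.differentiableAt (by fun_prop)]
  simp

/-- Schwarz's theorem, in a neighbourhood of the point. -/
lemma partialY_partialX_comm {f : ℝ × ℝ → ℝ} {p : ℝ × ℝ} (hf : AnalyticAt ℝ f p) :
    partialY (partialX f) =ᶠ[𝓝 p] partialX (partialY f) := by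
  filter_upwards [hf.eventually_analyticAt] with q hq
  rw [partialY_eq_fderiv (analyticAt_partialX hq).differentiableAt,
    partialX_eq_fderiv (analyticAt_partialY hq).differentiableAt,
    (partialX_eventuallyEq hq).fderiv_eq, (partialY_eventuallyEq hq).fderiv_eq,
    fderiv_fderiv_apply hq, fderiv_fderiv_apply hq]
  have hs : IsSymmSndFDerivAt ℝ f q := hq.contDiffAt.isSymmSndFDerivAt (n := ⊤) (by simp)
  exact hs.eq _ _

lemma iterate_partialY_congr {f g : ℝ × ℝ → ℝ} {p : ℝ × ℝ} (h : f =ᶠ[𝓝 p] g) (k : ℕ) :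
    partialY^[k] f =ᶠ[𝓝 p] partialY^[k] g := by
  induction k with
  | zero => exact h
  | succ n ih =>
    rw [Function.iterate_succ_apply', Function.iterate_succ_apply']
    exact partialY_congr ih

lemma iterate_partialX_congr {f g : ℝ × ℝ → ℝ} {p : ℝ × ℝ} (h : f =ᶠ[𝓝 p] g) (k : ℕ) :
    partialX^[k] f =ᶠ[𝓝 p] partialX^[k] g := by
  induction k with
  | zero => exact h
  | succ n ih =>
    rw [Function.iterate_succ_apply', Function.iterate_succ_apply']
    exact partialX_congr ih

lemma iterate_partialY_partialX {f : ℝ × ℝ → ℝ} {p : ℝ × ℝ} (hf : AnalyticAt ℝ f p) (k : ℕ) :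
    partialY^[k] (partialX f) =ᶠ[𝓝 p] partialX (partialY^[k] f) := by
  induction k generalizing f with
  | zero => rfl
  | succ n ih =>
    rw [Function.iterate_succ_apply, Function.iterate_succ_apply]
    exact (iterate_partialY_congr (partialY_partialX_comm hf) n).trans
      (ih (analyticAt_partialY hf))

lemma pderiv_partialX {f : ℝ × ℝ → ℝ} {p : ℝ × ℝ} (hf : AnalyticAt ℝ f p) (i k : ℕ) :
    pderiv (partialX f) p i k = pderiv f p (i + 1) k := by
  rw [pderiv_eq_iterate, pderiv_eq_iterate, Function.iterate_succ_apply]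
  exact (iterate_partialX_congr (iterate_partialY_partialX hf k) i).eq_of_nhds

lemma pderiv_partialY (f : ℝ × ℝ → ℝ) (p : ℝ × ℝ) (i k : ℕ) :
    pderiv (partialY f) p i k = pderiv f p i (k + 1) := by
  rw [pderiv_eq_iterate, pderiv_eq_iterate, Function.iterate_succ_apply]

lemma coef_partialX {f : ℝ × ℝ → ℝ} {p : ℝ × ℝ} (hf : AnalyticAt ℝ f p) (i k : ℕ) :
    coef (partialX f) p i k = (i + 1) * coef f p (i + 1) k := by
  rw [coef, coef, pderiv_partialX hf, Nat.factorial_succ]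
  push_cast
  have h1 : (i.factorial : ℝ) ≠ 0 := by positivity
  have h2 : (k.factorial : ℝ) ≠ 0 := by positivity
  field_simp

lemma coef_partialY (f : ℝ × ℝ → ℝ) (p : ℝ × ℝ) (i k : ℕ) :
    coef (partialY f) p i k = (k + 1) * coef f p i (k + 1) := by
  rw [coef, coef, pderiv_partialY, Nat.factorial_succ]
  push_cast
  have h1 : (i.factorial : ℝ) ≠ 0 := by positivity
  have h2 : (k.factorial : ℝ) ≠ 0 := by positivity
  field_simp

/-- The homogeneous part of degree `n` of the Taylor expansion of `f` at `p`, as a function of the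
displacement from `p`. -/
noncomputable def taylorHom (f : ℝ × ℝ → ℝ) (p : ℝ × ℝ) (n : ℕ) (z : ℝ × ℝ) : ℝ :=
  ∑ k ∈ antidiagonal n, coef f p k.1 k.2 * (z.1 ^ k.1 * z.2 ^ k.2)

lemma contDiff_taylorHom (f : ℝ × ℝ → ℝ) (p : ℝ × ℝ) (n : ℕ) :
    ContDiff ℝ ⊤ (taylorHom f p n) := by
  unfold taylorHom
  fun_prop

lemma taylorHom_smul (f : ℝ × ℝ → ℝ) (p : ℝ × ℝ) (n : ℕ) (c : ℝ) (z : ℝ × ℝ) :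
    taylorHom f p n (c • z) = c ^ n * taylorHom f p n z := by
  rw [taylorHom, taylorHom, mul_sum]
  refine sum_congr rfl fun k hk => ?_
  rw [← mem_antidiagonal.mp hk]
  simp only [Prod.smul_fst, Prod.smul_snd, smul_eq_mul, mul_pow, pow_add]
  ring

lemma taylorHom_zero (f : ℝ × ℝ → ℝ) (p z : ℝ × ℝ) : taylorHom f p 0 z = f p := by
  simp [taylorHom, coef, pderiv]

lemma partialX_taylorHom_succ {f : ℝ × ℝ → ℝ} {p : ℝ × ℝ} (hf : AnalyticAt ℝ f p) (n : ℕ) :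
    partialX (taylorHom f p (n + 1)) = taylorHom (partialX f) p n := by
  funext z
  have h : HasDerivAt (fun x => taylorHom f p (n + 1) (x, z.2))
      (∑ k ∈ antidiagonal (n + 1), coef f p k.1 k.2 * ((k.1 * z.1 ^ (k.1 - 1)) * z.2 ^ k.2))
      z.1 := by
    unfold taylorHom
    refine HasDerivAt.fun_sum fun k _ => ?_
    exact ((hasDerivAt_pow k.1 z.1).mul_const (z.2 ^ k.2)).const_mul (coef f p k.1 k.2)
  rw [partialX, h.deriv, Nat.sum_antidiagonal_succ, taylorHom]
  simp only [Nat.cast_zero, zero_mul, mul_zero, zero_add]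
  refine sum_congr rfl fun k _ => ?_
  rw [coef_partialX hf, Nat.add_sub_cancel]
  push_cast
  ring

lemma partialY_taylorHom_succ (f : ℝ × ℝ → ℝ) (p : ℝ × ℝ) (n : ℕ) :
    partialY (taylorHom f p (n + 1)) = taylorHom (partialY f) p n := by
  funext z
  have h : HasDerivAt (fun y => taylorHom f p (n + 1) (z.1, y))
      (∑ k ∈ antidiagonal (n + 1), coef f p k.1 k.2 * (z.1 ^ k.1 * (k.2 * z.2 ^ (k.2 - 1))))
      z.2 := by
    unfold taylorHom
    refine HasDerivAt.fun_sum fun k _ => ?_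
    exact ((hasDerivAt_pow k.2 z.2).const_mul (z.1 ^ k.1)).const_mul (coef f p k.1 k.2)
  rw [partialY, h.deriv, Nat.sum_antidiagonal_succ', taylorHom]
  simp only [Nat.cast_zero, zero_mul, mul_zero]
  rw [zero_add]
  refine sum_congr rfl fun k _ => ?_
  rw [coef_partialY, Nat.add_sub_cancel]
  push_cast
  ring

lemma norm_fderiv_le_partial {r : ℝ × ℝ → ℝ} {z : ℝ × ℝ} (hr : DifferentiableAt ℝ r z) :
    ‖fderiv ℝ r z‖ ≤ |partialX r z| + |partialY r z| := by
  rw [partialX_eq_fderiv hr, partialY_eq_fderiv hr]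
  refine ContinuousLinearMap.opNorm_le_bound _ (by positivity) fun v => ?_
  have hv : v = v.1 • ((1 : ℝ), (0 : ℝ)) + v.2 • ((0 : ℝ), (1 : ℝ)) := by ext <;> simp
  have e : fderiv ℝ r z v = v.1 * fderiv ℝ r z (1, 0) + v.2 * fderiv ℝ r z (0, 1) := by
    conv_lhs => rw [hv]
    rw [map_add, map_smul, map_smul, smul_eq_mul, smul_eq_mul]
  rw [e, add_mul, Real.norm_eq_abs]
  refine (abs_add_le _ _).trans (add_le_add ?_ ?_)
  · rw [abs_mul, mul_comm]
    exact mul_le_mul_of_nonneg_left (norm_fst_le v) (abs_nonneg _)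
  · rw [abs_mul, mul_comm]
    exact mul_le_mul_of_nonneg_left (norm_snd_le v) (abs_nonneg _)

/-- Integrating a bound on the gradient along segments from the origin. -/
lemma isBigO_pow_succ_of_partial {r : ℝ × ℝ → ℝ} {n : ℕ} (h0 : r 0 = 0)
    (hr : ∀ᶠ z in 𝓝 (0 : ℝ × ℝ), DifferentiableAt ℝ r z)
    (hx : partialX r =O[𝓝 0] fun z => ‖z‖ ^ n) (hy : partialY r =O[𝓝 0] fun z => ‖z‖ ^ n) :
    r =O[𝓝 0] fun z => ‖z‖ ^ (n + 1) := by
  obtain ⟨c, hc⟩ := hx.bound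
  obtain ⟨c', hc'⟩ := hy.bound
  obtain ⟨δ, hδ, hball⟩ := Metric.eventually_nhds_iff_ball.mp (hr.and (hc.and hc'))
  refine IsBigO.of_bound (c + c') ?_
  filter_upwards [Metric.ball_mem_nhds (0 : ℝ × ℝ) hδ] with z hz
  have hzδ : ‖z‖ < δ := by simpa using hz
  have hsub : ∀ w ∈ Metric.closedBall (0 : ℝ × ℝ) ‖z‖, w ∈ Metric.ball (0 : ℝ × ℝ) δ :=
    fun w hw => Metric.closedBall_subset_ball hzδ hw
  have hcc : 0 ≤ (c + c') * ‖z‖ ^ n := by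
    have := (hball z hz).2
    have h1 := (norm_nonneg _).trans this.1
    have h2 := (norm_nonneg _).trans this.2
    rw [Real.norm_of_nonneg (by positivity)] at h1 h2
    linarith
  have key := Convex.norm_image_sub_le_of_norm_fderiv_le (𝕜 := ℝ) (f := r)
    (s := Metric.closedBall (0 : ℝ × ℝ) ‖z‖) (C := (c + c') * ‖z‖ ^ n)
    (fun w hw => (hball w (hsub w hw)).1) (fun w hw => ?_) (convex_closedBall _ _)
    (x := 0) (y := z) (by simp) (by simp)
  · rw [h0, sub_zero, sub_zero] at key
    rw [norm_pow, norm_norm, pow_succ, ← mul_assoc]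
    exact key
  · obtain ⟨hd, h1, h2⟩ := hball w (hsub w hw)
    refine (norm_fderiv_le_partial hd).trans ?_
    rw [Real.norm_eq_abs, norm_pow, norm_norm] at h1 h2
    have hw' : ‖w‖ ≤ ‖z‖ := by simpa using hw
    -- the constants `c` and `c'` are only known to be nonnegative if `‖z‖ ^ n ≠ 0`
    by_cases hz0 : ‖z‖ ^ n = 0
    · have : ‖w‖ ^ n = 0 :=
        le_antisymm (hz0 ▸ pow_le_pow_left₀ (norm_nonneg w) hw' n) (by positivity)
      rw [this] at h1 h2
      rw [hz0]
      linarith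
    · have hpos : 0 ≤ c + c' := by
        by_contra hneg
        have : 0 < ‖z‖ ^ n := lt_of_le_of_ne (by positivity) (Ne.symm hz0)
        nlinarith
      calc _ ≤ (c + c') * ‖w‖ ^ n := by linarith
        _ ≤ _ := by gcongr

lemma partialX_sub {f g : ℝ × ℝ → ℝ} {q : ℝ × ℝ} (hf : DifferentiableAt ℝ f q)
    (hg : DifferentiableAt ℝ g q) :
    partialX (fun z => f z - g z) q = partialX f q - partialX g q := by
  rw [partialX_eq_fderiv hf, partialX_eq_fderiv hg, partialX_eq_fderiv (hf.fun_sub hg)]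
  exact congrArg (fun L => L (1, 0)) (fderiv_fun_sub hf hg)

lemma partialY_sub {f g : ℝ × ℝ → ℝ} {q : ℝ × ℝ} (hf : DifferentiableAt ℝ f q)
    (hg : DifferentiableAt ℝ g q) :
    partialY (fun z => f z - g z) q = partialY f q - partialY g q := by
  rw [partialY_eq_fderiv hf, partialY_eq_fderiv hg, partialY_eq_fderiv (hf.fun_sub hg)]
  exact congrArg (fun L => L (0, 1)) (fderiv_fun_sub hf hg)

lemma partialX_sum {n : ℕ} {f : ℕ → ℝ × ℝ → ℝ} {q : ℝ × ℝ}
    (hf : ∀ j, DifferentiableAt ℝ (f j) q) :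
    partialX (fun z => ∑ j ∈ range n, f j z) q = ∑ j ∈ range n, partialX (f j) q := by
  rw [partialX_eq_fderiv (DifferentiableAt.fun_sum fun j _ => hf j),
    fderiv_fun_sum fun j _ => hf j, _root_.sum_apply]
  exact sum_congr rfl fun j _ => (partialX_eq_fderiv (hf j)).symm

lemma partialY_sum {n : ℕ} {f : ℕ → ℝ × ℝ → ℝ} {q : ℝ × ℝ}
    (hf : ∀ j, DifferentiableAt ℝ (f j) q) :
    partialY (fun z => ∑ j ∈ range n, f j z) q = ∑ j ∈ range n, partialY (f j) q := by
  rw [partialY_eq_fderiv (DifferentiableAt.fun_sum fun j _ => hf j),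
    fderiv_fun_sum fun j _ => hf j, _root_.sum_apply]
  exact sum_congr rfl fun j _ => (partialY_eq_fderiv (hf j)).symm

lemma partialX_comp_add (f : ℝ × ℝ → ℝ) (p z : ℝ × ℝ) :
    partialX (fun z => f (p + z)) z = partialX f (p + z) := by
  simp only [partialX, Prod.fst_add, Prod.snd_add]
  exact deriv_comp_const_add (f := fun x => f (x, p.2 + z.2)) p.1 z.1

lemma partialY_comp_add (f : ℝ × ℝ → ℝ) (p z : ℝ × ℝ) :
    partialY (fun z => f (p + z)) z = partialY f (p + z) := by
  simp only [partialY, Prod.fst_add, Prod.snd_add]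
  exact deriv_comp_const_add (f := fun y => f (p.1 + z.1, y)) p.2 z.2

/-- Taylor's formula in two variables with the iterated one-variable derivatives of `pderiv` as
coefficients. The induction on the order differentiates the remainder: each of its partial
derivatives is the remainder, of one order less, of the same partial derivative of `f`. -/
theorem taylor_isBigO {f : ℝ × ℝ → ℝ} {p : ℝ × ℝ} (hf : AnalyticAt ℝ f p) (n : ℕ) :
    (fun z => f (p + z) - ∑ j ∈ range n, taylorHom f p j z) =O[𝓝 0] fun z => ‖z‖ ^ n := by
  have htend : Tendsto (fun z : ℝ × ℝ => p + z) (𝓝 0) (𝓝 p) := by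
    have : ContinuousAt (fun z : ℝ × ℝ => p + z) 0 := by fun_prop
    simpa [ContinuousAt] using this
  induction n generalizing f with
  | zero =>
    simp only [range_zero, sum_empty, sub_zero, pow_zero]
    exact (hf.continuousAt.tendsto.comp htend).isBigO_one ℝ
  | succ n ih =>
    have hT : ∀ (f : ℝ × ℝ → ℝ) j z, DifferentiableAt ℝ (taylorHom f p j) z := fun f j z =>
      ((contDiff_taylorHom f p j).differentiable (by simp)) z
    have hd : ∀ᶠ z in 𝓝 (0 : ℝ × ℝ), DifferentiableAt ℝ (fun z => f (p + z)) z := by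
      filter_upwards [htend.eventually hf.eventually_analyticAt] with z hz
      exact hz.differentiableAt.comp z (by fun_prop)
    have hS : ∀ m z, DifferentiableAt ℝ (fun z => ∑ j ∈ range m, taylorHom f p j z) z :=
      fun m z => DifferentiableAt.fun_sum fun j _ => hT f j z
    have hX0 : ∀ z, partialX (taylorHom f p 0) z = 0 := fun z => by
      simp [partialX, taylorHom_zero]
    have hY0 : ∀ z, partialY (taylorHom f p 0) z = 0 := fun z => by
      simp [partialY, taylorHom_zero]
    refine isBigO_pow_succ_of_partial ?_ (hd.mono fun z hz => hz.sub (hS _ z)) ?_ ?_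
    · rw [sum_range_succ']
      have : ∀ j, taylorHom f p (j + 1) 0 = 0 := fun j => by
        have := taylorHom_smul f p (j + 1) 0 0
        simpa using this
      simp [this, taylorHom_zero]
    · refine (ih (analyticAt_partialX hf)).congr' ?_ EventuallyEq.rfl
      filter_upwards [hd] with z hz
      rw [partialX_sub hz (hS _ z), partialX_comp_add, partialX_sum (fun j => hT f j z),
        sum_range_succ', hX0, add_zero]
      simp only [partialX_taylorHom_succ hf]
    · refine (ih (analyticAt_partialY hf)).congr' ?_ EventuallyEq.rfl
      filter_upwards [hd] with z hz
      rw [partialY_sub hz (hS _ z), partialY_comp_add, partialY_sum (fun j => hT f j z),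
        sum_range_succ', hY0, add_zero]
      simp only [partialY_taylorHom_succ]

/-! ### Gaussian integrals on the plane -/

/-- Growth at most polynomial, on the whole plane. -/
def PolyGrowth (h : ℝ × ℝ → ℝ) : Prop :=
  ∃ (c : ℝ) (m : ℕ), ∀ u, |h u| ≤ c * (1 + ‖u‖) ^ m

lemma nonneg_of_abs_le_mul_pow {x c t : ℝ} {m : ℕ} (ht : 0 ≤ t) (h : |x| ≤ c * (1 + t) ^ m) :
    0 ≤ c :=
  nonneg_of_mul_nonneg_left ((abs_nonneg x).trans h) (by positivity)

lemma PolyGrowth.const (c : ℝ) : PolyGrowth fun _ => c := ⟨|c|, 0, fun u => by simp⟩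

lemma PolyGrowth.add {f g : ℝ × ℝ → ℝ} (hf : PolyGrowth f) (hg : PolyGrowth g) :
    PolyGrowth fun u => f u + g u := by
  obtain ⟨c, m, h⟩ := hf
  obtain ⟨c', m', h'⟩ := hg
  refine ⟨c + c', m + m', fun u => ?_⟩
  have hc := nonneg_of_abs_le_mul_pow (norm_nonneg u) (h u)
  have hc' := nonneg_of_abs_le_mul_pow (norm_nonneg u) (h' u)
  have h1 : 1 ≤ 1 + ‖u‖ := by simp
  calc |f u + g u| ≤ |f u| + |g u| := abs_add_le _ _
    _ ≤ c * (1 + ‖u‖) ^ m + c' * (1 + ‖u‖) ^ m' := add_le_add (h u) (h' u)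
    _ ≤ c * (1 + ‖u‖) ^ (m + m') + c' * (1 + ‖u‖) ^ (m + m') := by
      gcongr <;> first | exact h1 | omega
    _ = _ := by ring

lemma PolyGrowth.mul {f g : ℝ × ℝ → ℝ} (hf : PolyGrowth f) (hg : PolyGrowth g) :
    PolyGrowth fun u => f u * g u := by
  obtain ⟨c, m, h⟩ := hf
  obtain ⟨c', m', h'⟩ := hg
  refine ⟨c * c', m + m', fun u => ?_⟩
  have hc := nonneg_of_abs_le_mul_pow (norm_nonneg u) (h u)
  calc |f u * g u| = |f u| * |g u| := abs_mul _ _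
    _ ≤ c * (1 + ‖u‖) ^ m * (c' * (1 + ‖u‖) ^ m') :=
      mul_le_mul (h u) (h' u) (abs_nonneg _) (by positivity)
    _ = _ := by rw [pow_add]; ring

lemma PolyGrowth.abs {f : ℝ × ℝ → ℝ} (hf : PolyGrowth f) : PolyGrowth fun u => |f u| := by
  obtain ⟨c, m, h⟩ := hf
  exact ⟨c, m, fun u => by simpa using h u⟩

lemma polyGrowth_norm_pow (n : ℕ) : PolyGrowth fun u => ‖u‖ ^ n := by
  refine ⟨1, n, fun u => ?_⟩
  rw [abs_of_nonneg (by positivity), one_mul]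
  exact pow_le_pow_left₀ (norm_nonneg u) (by linarith) n

lemma abs_monomial_le (i j : ℕ) (u : ℝ × ℝ) : |u.1 ^ i * u.2 ^ j| ≤ ‖u‖ ^ (i + j) := by
  rw [abs_mul, abs_pow, abs_pow, pow_add]
  gcongr
  · exact norm_fst_le u
  · exact norm_snd_le u

lemma polyGrowth_monomial (i j : ℕ) : PolyGrowth fun u => u.1 ^ i * u.2 ^ j := by
  obtain ⟨c, m, h⟩ := polyGrowth_norm_pow (i + j)
  exact ⟨c, m, fun u => (abs_monomial_le i j u).trans ((le_abs_self _).trans (h u))⟩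

lemma PolyGrowth.sum {ι : Type*} (s : Finset ι) {f : ι → ℝ × ℝ → ℝ}
    (hf : ∀ i ∈ s, PolyGrowth (f i)) : PolyGrowth fun u => ∑ i ∈ s, f i u := by
  classical
  induction s using Finset.induction_on with
  | empty => simpa using PolyGrowth.const 0
  | insert i s hi ih =>
    simp only [sum_insert hi]
    exact (hf i (by simp)).add (ih fun j hj => hf j (by simp [hj]))

lemma polyGrowth_taylorHom (f : ℝ × ℝ → ℝ) (p : ℝ × ℝ) (n : ℕ) : PolyGrowth (taylorHom f p n) :=
  PolyGrowth.sum _ fun k _ => (PolyGrowth.const _).mul (polyGrowth_monomial k.1 k.2)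

/-- A power is absorbed by any Gaussian: bound it by `m! exp (1 + t)` and complete the square. -/
lemma one_add_pow_le_exp {l : ℝ} (hl : 0 < l) (m : ℕ) {t : ℝ} (ht : 0 ≤ t) :
    (1 + t) ^ m ≤ m.factorial * exp (1 + 1 / (2 * l)) * exp (l / 2 * t ^ 2) := by
  have h1 : (1 + t) ^ m ≤ m.factorial * exp (1 + t) := by
    have := Real.pow_div_factorial_le_exp (1 + t) (by positivity) m
    rwa [div_le_iff₀ (by positivity), mul_comm] at this
  refine h1.trans ?_
  rw [mul_assoc, ← exp_add]
  refine mul_le_mul_of_nonneg_left (exp_le_exp.mpr ?_) (by positivity)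
  have : 0 ≤ (l * t - 1) ^ 2 / (2 * l) := by positivity
  have e : (l * t - 1) ^ 2 / (2 * l) = l / 2 * t ^ 2 - t + 1 / (2 * l) := by
    field_simp
    ring
  linarith

lemma sq_add_sq_le_norm_sq (u : ℝ × ℝ) : (u.1 ^ 2 + u.2 ^ 2) / 2 ≤ ‖u‖ ^ 2 := by
  have h1 : u.1 ^ 2 ≤ ‖u‖ ^ 2 := by
    rw [← sq_abs]
    exact pow_le_pow_left₀ (abs_nonneg _) (norm_fst_le u) 2
  have h2 : u.2 ^ 2 ≤ ‖u‖ ^ 2 := by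
    rw [← sq_abs]
    exact pow_le_pow_left₀ (abs_nonneg _) (norm_snd_le u) 2
  linarith

lemma integrable_exp_neg_mul_norm_sq {l : ℝ} (hl : 0 < l) :
    Integrable fun u : ℝ × ℝ => exp (-(l * ‖u‖ ^ 2)) := by
  have h := (integrable_exp_neg_mul_sq (b := l / 2) (by positivity)).mul_prod
    (integrable_exp_neg_mul_sq (b := l / 2) (by positivity))
  refine h.mono' (by fun_prop) (Eventually.of_forall fun u => ?_)
  rw [Real.norm_of_nonneg (exp_pos _).le, ← exp_add]
  gcongr
  have := mul_le_mul_of_nonneg_left (sq_add_sq_le_norm_sq u) hl.le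
  linarith

lemma integrable_pow_mul_exp {l : ℝ} (hl : 0 < l) (m : ℕ) :
    Integrable fun u : ℝ × ℝ => (1 + ‖u‖) ^ m * exp (-(l * ‖u‖ ^ 2)) := by
  refine ((integrable_exp_neg_mul_norm_sq (half_pos hl)).const_mul
    (m.factorial * exp (1 + 1 / (2 * l)))).mono' (by fun_prop) (Eventually.of_forall fun u => ?_)
  rw [Real.norm_of_nonneg (by positivity)]
  calc _ ≤ (m.factorial * exp (1 + 1 / (2 * l)) * exp (l / 2 * ‖u‖ ^ 2)) *
        exp (-(l * ‖u‖ ^ 2)) := by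
        gcongr
        exact one_add_pow_le_exp hl m (norm_nonneg u)
    _ = _ := by
      rw [mul_assoc, ← exp_add]
      ring_nf

/-- The quadratic form `½ uᵀ A u` of the matrix `A = !![α, β; β, γ]`. -/
noncomputable def quad (α β γ : ℝ) (u : ℝ × ℝ) : ℝ :=
  (α * u.1 ^ 2 + 2 * β * (u.1 * u.2) + γ * u.2 ^ 2) / 2

@[fun_prop]
lemma continuous_quad (α β γ : ℝ) : Continuous (quad α β γ) := by
  unfold quad
  fun_prop

lemma quad_smul (α β γ c : ℝ) (u : ℝ × ℝ) : quad α β γ (c • u) = c ^ 2 * quad α β γ u := by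
  simp only [quad, Prod.smul_fst, Prod.smul_snd, smul_eq_mul]
  ring

lemma exists_mul_norm_sq_le_quad {α β γ : ℝ} (hα : 0 < α) (hD : 0 < α * γ - β ^ 2) :
    ∃ l > 0, ∀ u, l * ‖u‖ ^ 2 ≤ quad α β γ u := by
  have hγ : 0 < γ := by
    by_contra h
    nlinarith [sq_nonneg β]
  refine ⟨min ((α * γ - β ^ 2) / (2 * γ)) ((α * γ - β ^ 2) / (2 * α)), by positivity, fun u => ?_⟩
  have h1 : (α * γ - β ^ 2) / (2 * γ) * u.1 ^ 2 ≤ quad α β γ u := by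
    have : 0 ≤ (β * u.1 + γ * u.2) ^ 2 / (2 * γ) := by positivity
    have e : quad α β γ u - (α * γ - β ^ 2) / (2 * γ) * u.1 ^ 2 =
        (β * u.1 + γ * u.2) ^ 2 / (2 * γ) := by
      rw [quad]
      field_simp
      ring
    linarith
  have h2 : (α * γ - β ^ 2) / (2 * α) * u.2 ^ 2 ≤ quad α β γ u := by
    have : 0 ≤ (α * u.1 + β * u.2) ^ 2 / (2 * α) := by positivity
    have e : quad α β γ u - (α * γ - β ^ 2) / (2 * α) * u.2 ^ 2 =
        (α * u.1 + β * u.2) ^ 2 / (2 * α) := by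
      rw [quad]
      field_simp
      ring
    linarith
  rw [Prod.norm_def, Real.norm_eq_abs, Real.norm_eq_abs]
  rcases le_total |u.1| |u.2| with h | h
  · rw [max_eq_right h, sq_abs]
    exact (mul_le_mul_of_nonneg_right (min_le_right _ _) (sq_nonneg _)).trans h2
  · rw [max_eq_left h, sq_abs]
    exact (mul_le_mul_of_nonneg_right (min_le_left _ _) (sq_nonneg _)).trans h1

lemma integrable_exp_neg_quad_mul {α β γ : ℝ} (hα : 0 < α) (hD : 0 < α * γ - β ^ 2)
    {h : ℝ × ℝ → ℝ} (hc : Continuous h) (hg : PolyGrowth h) :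
    Integrable fun u => exp (-quad α β γ u) * h u := by
  obtain ⟨l, hl, hlq⟩ := exists_mul_norm_sq_le_quad hα hD
  obtain ⟨c, m, hcm⟩ := hg
  refine ((integrable_pow_mul_exp hl m).const_mul c).mono' (by fun_prop)
    (Eventually.of_forall fun u => ?_)
  rw [norm_mul, Real.norm_of_nonneg (exp_pos _).le, Real.norm_eq_abs, ← mul_assoc, mul_comm]
  have := hlq u
  exact mul_le_mul (hcm u) (exp_le_exp.mpr (by linarith)) (exp_pos _).le
    ((abs_nonneg _).trans (hcm u))

lemma integral_exp_neg_quad {α β γ : ℝ} (hα : 0 < α) (hD : 0 < α * γ - β ^ 2) :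
    ∫ u, exp (-quad α β γ u) = 2 * π / √(α * γ - β ^ 2) := by
  have hint : Integrable fun u : ℝ × ℝ => exp (-quad α β γ u) := by
    simpa using integrable_exp_neg_quad_mul hα hD (continuous_const (y := (1 : ℝ)))
      (PolyGrowth.const 1)
  have hinner : ∀ y : ℝ, ∫ x : ℝ, exp (-quad α β γ (x, y)) =
      √(π / (α / 2)) * exp (-((α * γ - β ^ 2) / (2 * α)) * y ^ 2) := by
    intro y
    have e : ∀ x : ℝ, exp (-quad α β γ (x, y)) =
        exp (-((α * γ - β ^ 2) / (2 * α)) * y ^ 2) * exp (-(α / 2) * (x + β * y / α) ^ 2) := by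
      intro x
      rw [← exp_add, quad]
      congr 1
      field_simp
      ring
    simp only [e]
    rw [integral_const_mul, integral_add_right_eq_self (fun x : ℝ => exp (-(α / 2) * x ^ 2)),
      integral_gaussian, mul_comm]
  rw [Measure.volume_eq_prod, integral_prod_symm _ (by rwa [← Measure.volume_eq_prod])]
  simp only [hinner]
  rw [integral_const_mul, integral_gaussian, ← sqrt_mul (by positivity)]
  have e : π / (α / 2) * (π / ((α * γ - β ^ 2) / (2 * α))) = (2 * π) ^ 2 / (α * γ - β ^ 2) := by
    field_simp
  rw [e, sqrt_div (by positivity), sqrt_sq (by positivity)]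

/-- The expectation of `h` under the centred Gaussian law on the plane with inverse covariance
matrix `!![α, β; β, γ]`. -/
noncomputable def gaussAvg (α β γ : ℝ) (h : ℝ × ℝ → ℝ) : ℝ :=
  √(α * γ - β ^ 2) / (2 * π) * ∫ u, exp (-quad α β γ u) * h u

lemma gaussAvg_const {α β γ : ℝ} (hα : 0 < α) (hD : 0 < α * γ - β ^ 2) (c : ℝ) :
    gaussAvg α β γ (fun _ => c) = c := by
  rw [gaussAvg, integral_mul_const, integral_exp_neg_quad hα hD]
  have : √(α * γ - β ^ 2) ≠ 0 := (sqrt_pos.mpr hD).ne'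
  field_simp

lemma gaussAvg_odd (α β γ : ℝ) {h : ℝ × ℝ → ℝ} (hh : ∀ u, h (-u) = -h u) :
    gaussAvg α β γ h = 0 := by
  have e : ∫ u, exp (-quad α β γ u) * h u = -∫ u, exp (-quad α β γ u) * h u := by
    rw [← integral_neg, ← integral_neg_eq_self]
    refine integral_congr_ae (Eventually.of_forall fun u => ?_)
    simp only [hh, quad, Prod.fst_neg, Prod.snd_neg]
    ring_nf
  rw [gaussAvg, self_eq_neg.mp e, mul_zero]

lemma gaussAvg_const_mul (α β γ c : ℝ) (h : ℝ × ℝ → ℝ) :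
    gaussAvg α β γ (fun u => c * h u) = c * gaussAvg α β γ h := by
  have e : ∀ u, exp (-quad α β γ u) * (c * h u) = c * (exp (-quad α β γ u) * h u) := fun u => by
    ring
  simp only [gaussAvg, e, integral_const_mul]
  ring

lemma gaussAvg_add {α β γ : ℝ} (hα : 0 < α) (hD : 0 < α * γ - β ^ 2) {h k : ℝ × ℝ → ℝ}
    (hc : Continuous h) (hg : PolyGrowth h) (kc : Continuous k) (kg : PolyGrowth k) :
    gaussAvg α β γ (fun u => h u + k u) = gaussAvg α β γ h + gaussAvg α β γ k := by
  simp only [gaussAvg, mul_add]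
  rw [integral_add (integrable_exp_neg_quad_mul hα hD hc hg)
    (integrable_exp_neg_quad_mul hα hD kc kg), mul_add]

lemma gaussAvg_sum {α β γ : ℝ} (hα : 0 < α) (hD : 0 < α * γ - β ^ 2) {ι : Type*} (s : Finset ι)
    {h : ι → ℝ × ℝ → ℝ} (hc : ∀ i ∈ s, Continuous (h i)) (hg : ∀ i ∈ s, PolyGrowth (h i)) :
    gaussAvg α β γ (fun u => ∑ i ∈ s, h i u) = ∑ i ∈ s, gaussAvg α β γ (h i) := by
  simp only [gaussAvg, mul_sum]
  rw [integral_finsetSum s fun i hi => integrable_exp_neg_quad_mul hα hD (hc i hi) (hg i hi),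
    mul_sum]

lemma integral_comp_smul_plane (f : ℝ × ℝ → ℝ) (c : ℝ) :
    ∫ u, f (c • u) = (c ^ 2)⁻¹ * ∫ u, f u := by
  rw [Measure.integral_comp_smul]
  simp

/-- An even Gaussian moment for the covariance matrix `D A⁻¹`, with `D = det A`, in terms of the
moment for the covariance matrix `A⁻¹`. -/
lemma gaussMoment_smul_inv {α β γ : ℝ} (hD : 0 < α * γ - β ^ 2) {i j n : ℕ} (hij : i + j = 2 * n) :
    gaussMoment ((α * γ - β ^ 2) • (!![α, β; β, γ])⁻¹) i j =
      (α * γ - β ^ 2) ^ n * gaussAvg α β γ (fun u => u.1 ^ i * u.2 ^ j) := by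
  set d := α * γ - β ^ 2 with hd
  have hdet : (!![α, β; β, γ]).det = d := by rw [Matrix.det_fin_two_of, hd]; ring
  have hu : IsUnit (!![α, β; β, γ]).det := by rw [hdet]; exact hD.ne'.isUnit
  have hS : (d • (!![α, β; β, γ])⁻¹).det = d := by
    rw [Matrix.det_smul, Matrix.det_nonsing_inv, hdet, Fintype.card_fin, Ring.inverse_eq_inv']
    field_simp
  have hinv : (d • (!![α, β; β, γ])⁻¹)⁻¹ = d⁻¹ • !![α, β; β, γ] := by
    refine Matrix.inv_eq_right_inv ?_
    rw [Matrix.smul_mul, Matrix.mul_smul, Matrix.nonsing_inv_mul _ hu, smul_smul,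
      mul_inv_cancel₀ hD.ne', one_smul]
  rw [gaussMoment, hS, hinv, gaussAvg, ← hd]
  have hs : √d ≠ 0 := (sqrt_pos.mpr hD).ne'
  have key := integral_comp_smul_plane (fun q : ℝ × ℝ => q.1 ^ i * q.2 ^ j *
      exp (-(1 / 2) * (![q.1, q.2] ⬝ᵥ ((d⁻¹ • !![α, β; β, γ]) *ᵥ ![q.1, q.2])))) (√d)
  have e : ∀ u : ℝ × ℝ, ((√d • u).1 ^ i * (√d • u).2 ^ j *
      exp (-(1 / 2) * (![(√d • u).1, (√d • u).2] ⬝ᵥ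
        ((d⁻¹ • !![α, β; β, γ]) *ᵥ ![(√d • u).1, (√d • u).2])))) =
      d ^ n * (exp (-quad α β γ u) * (u.1 ^ i * u.2 ^ j)) := by
    intro u
    have h1 : -(1 / 2) * (![(√d • u).1, (√d • u).2] ⬝ᵥ
        ((d⁻¹ • !![α, β; β, γ]) *ᵥ ![(√d • u).1, (√d • u).2])) = -quad α β γ u := by
      have hsq : √d * √d = d := mul_self_sqrt hD.le
      simp [Matrix.mulVec, dotProduct, Fin.sum_univ_two, quad]
      field_simp
      linear_combination (α * u.1 ^ 2 + 2 * β * u.1 * u.2 + γ * u.2 ^ 2) * hsq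
    have h2 : (√d • u).1 ^ i * (√d • u).2 ^ j = d ^ n * (u.1 ^ i * u.2 ^ j) := by
      have : √d ^ (i + j) = d ^ n := by rw [hij, pow_mul, sq_sqrt hD.le]
      rw [← this]
      simp only [Prod.smul_fst, Prod.smul_snd, smul_eq_mul]
      ring
    rw [h1, h2]
    ring
  simp only [e] at key
  rw [integral_const_mul, sq_sqrt hD.le] at key
  have hJ := (eq_inv_mul_iff_mul_eq₀ hD.ne').mp key
  rw [← hJ]
  have hsq : √d ^ 2 = d := sq_sqrt hD.le
  field_simp
  rw [hsq]

/-! ### Expansions in the scaling parameter -/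

/-- `f ε u = ∑_{k < 4} ε ^ k * c k u + O(ε ^ 4)` for `0 < ε ≤ 1` and `ε * ‖u‖ < δ`, where the
implied constant grows at most polynomially in `u`. -/
def HasExpansion (δ : ℝ) (f : ℝ → ℝ × ℝ → ℝ) (c : ℕ → ℝ × ℝ → ℝ) : Prop :=
  ∃ h, PolyGrowth h ∧ ∀ ε, 0 < ε → ε ≤ 1 → ∀ u, ε * ‖u‖ < δ →
    |f ε u - ∑ k ∈ range 4, ε ^ k * c k u| ≤ ε ^ 4 * h u

/-- Coefficients of the product of two power series with coefficients `c` and `d`. -/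
def cauchyProd (c d : ℕ → ℝ × ℝ → ℝ) (k : ℕ) (u : ℝ × ℝ) : ℝ :=
  ∑ ij ∈ antidiagonal k, c ij.1 u * d ij.2 u

lemma polyGrowth_cauchyProd {c d : ℕ → ℝ × ℝ → ℝ} (hc : ∀ k, PolyGrowth (c k))
    (hd : ∀ k, PolyGrowth (d k)) (k : ℕ) : PolyGrowth (cauchyProd c d k) :=
  PolyGrowth.sum _ fun ij _ => (hc ij.1).mul (hd ij.2)

lemma continuous_cauchyProd {c d : ℕ → ℝ × ℝ → ℝ} (hc : ∀ k, Continuous (c k))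
    (hd : ∀ k, Continuous (d k)) (k : ℕ) : Continuous (cauchyProd c d k) :=
  continuous_finsetSum _ fun ij _ => (hc ij.1).mul (hd ij.2)

lemma cauchyProd_neg {c d : ℕ → ℝ × ℝ → ℝ} (hc : ∀ k u, c k (-u) = (-1) ^ k * c k u)
    (hd : ∀ k u, d k (-u) = (-1) ^ k * d k u) (k : ℕ) (u : ℝ × ℝ) :
    cauchyProd c d k (-u) = (-1) ^ k * cauchyProd c d k u := by
  rw [cauchyProd, cauchyProd, mul_sum]
  refine sum_congr rfl fun ij hij => ?_
  rw [hc, hd, ← mem_antidiagonal.mp hij, pow_add]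
  ring

lemma HasExpansion.anti {δ δ' : ℝ} {f : ℝ → ℝ × ℝ → ℝ} {c : ℕ → ℝ × ℝ → ℝ}
    (hf : HasExpansion δ f c) (h : δ' ≤ δ) : HasExpansion δ' f c := by
  obtain ⟨w, hw, H⟩ := hf
  exact ⟨w, hw, fun ε h0 h1 u hu => H ε h0 h1 u (hu.trans_le h)⟩

lemma HasExpansion.add {δ : ℝ} {f g : ℝ → ℝ × ℝ → ℝ} {c d : ℕ → ℝ × ℝ → ℝ}
    (hf : HasExpansion δ f c) (hg : HasExpansion δ g d) :
    HasExpansion δ (fun ε u => f ε u + g ε u) (fun k u => c k u + d k u) := by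
  obtain ⟨w, hw, H⟩ := hf
  obtain ⟨w', hw', H'⟩ := hg
  refine ⟨_, hw.add hw', fun ε h0 h1 u hu => ?_⟩
  simp only [mul_add, sum_add_distrib]
  rw [add_sub_add_comm]
  exact (abs_add_le _ _).trans (add_le_add (H ε h0 h1 u hu) (H' ε h0 h1 u hu))

lemma HasExpansion.const_mul {δ : ℝ} {f : ℝ → ℝ × ℝ → ℝ} {c : ℕ → ℝ × ℝ → ℝ}
    (hf : HasExpansion δ f c) (a : ℝ) :
    HasExpansion δ (fun ε u => a * f ε u) (fun k u => a * c k u) := by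
  obtain ⟨w, hw, H⟩ := hf
  refine ⟨_, (PolyGrowth.const |a|).mul hw, fun ε h0 h1 u hu => ?_⟩
  have e : a * f ε u - ∑ k ∈ range 4, ε ^ k * (a * c k u) =
      a * (f ε u - ∑ k ∈ range 4, ε ^ k * c k u) := by
    rw [mul_sub, mul_sum]
    congr 1
    exact sum_congr rfl fun k _ => by ring
  rw [e, abs_mul, mul_left_comm]
  exact mul_le_mul_of_nonneg_left (H ε h0 h1 u hu) (abs_nonneg a)

/-- A function of `u` alone, as a constant in `ε`. -/
lemma hasExpansion_const (δ : ℝ) (q : ℝ × ℝ → ℝ) :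
    HasExpansion δ (fun _ u => q u) (fun k u => if k = 0 then q u else 0) :=
  ⟨_, PolyGrowth.const 0, fun ε _ _ u _ => by simp⟩

lemma abs_expansion_sum_le {ε : ℝ} (h0 : 0 < ε) (h1 : ε ≤ 1) (c : ℕ → ℝ × ℝ → ℝ) (u : ℝ × ℝ) :
    |∑ k ∈ range 4, ε ^ k * c k u| ≤ ∑ k ∈ range 4, |c k u| := by
  refine (abs_sum_le_sum_abs _ _).trans (sum_le_sum fun k _ => ?_)
  rw [abs_mul, abs_of_nonneg (by positivity)]
  exact mul_le_of_le_one_left (abs_nonneg _) (pow_le_one₀ h0.le h1)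

lemma HasExpansion.exists_abs_le {δ : ℝ} {f : ℝ → ℝ × ℝ → ℝ} {c : ℕ → ℝ × ℝ → ℝ}
    (hf : HasExpansion δ f c) (hc : ∀ k, PolyGrowth (c k)) :
    ∃ w, PolyGrowth w ∧ ∀ ε, 0 < ε → ε ≤ 1 → ∀ u, ε * ‖u‖ < δ → |f ε u| ≤ w u := by
  obtain ⟨w, hw, H⟩ := hf
  refine ⟨_, hw.add (PolyGrowth.sum (range 4) fun k _ => (hc k).abs), fun ε h0 h1 u hu => ?_⟩
  have h2 := H ε h0 h1 u hu
  have h3 := abs_expansion_sum_le h0 h1 c u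
  have hw0 : 0 ≤ w u :=
    nonneg_of_mul_nonneg_right ((abs_nonneg _).trans h2) (by positivity)
  have h4 : ε ^ 4 * w u ≤ w u := mul_le_of_le_one_left hw0 (pow_le_one₀ h0.le h1)
  have h5 := abs_sub_abs_le_abs_sub (f ε u) (∑ k ∈ range 4, ε ^ k * c k u)
  linarith

lemma abs_cauchyProd_truncation_le {ε : ℝ} (h0 : 0 < ε) (h1 : ε ≤ 1) (c d : ℕ → ℝ × ℝ → ℝ)
    (u : ℝ × ℝ) :
    |(∑ k ∈ range 4, ε ^ k * c k u) * (∑ k ∈ range 4, ε ^ k * d k u) -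
      ∑ k ∈ range 4, ε ^ k * cauchyProd c d k u| ≤
    ε ^ 4 * (|c 1 u * d 3 u + c 2 u * d 2 u + c 3 u * d 1 u| +
      (|c 2 u * d 3 u + c 3 u * d 2 u| + |c 3 u * d 3 u|)) := by
  have e : (∑ k ∈ range 4, ε ^ k * c k u) * (∑ k ∈ range 4, ε ^ k * d k u) -
      ∑ k ∈ range 4, ε ^ k * cauchyProd c d k u =
      ε ^ 4 * ((c 1 u * d 3 u + c 2 u * d 2 u + c 3 u * d 1 u) +
        (ε * (c 2 u * d 3 u + c 3 u * d 2 u) + ε ^ 2 * (c 3 u * d 3 u))) := by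
    simp only [cauchyProd, sum_range_succ, sum_range_zero, Nat.sum_antidiagonal_succ,
      Nat.antidiagonal_zero, sum_singleton]
    ring
  rw [e, abs_mul, abs_of_nonneg (by positivity : (0 : ℝ) ≤ ε ^ 4)]
  refine mul_le_mul_of_nonneg_left ?_ (by positivity)
  refine (abs_add_le _ _).trans (add_le_add le_rfl ((abs_add_le _ _).trans (add_le_add ?_ ?_)))
  · rw [abs_mul, abs_of_pos h0]
    exact mul_le_of_le_one_left (abs_nonneg _) h1
  · rw [abs_mul, abs_of_nonneg (by positivity)]
    exact mul_le_of_le_one_left (abs_nonneg _) (pow_le_one₀ h0.le h1)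

lemma HasExpansion.mul {δ : ℝ} {f g : ℝ → ℝ × ℝ → ℝ} {c d : ℕ → ℝ × ℝ → ℝ}
    (hf : HasExpansion δ f c) (hg : HasExpansion δ g d) (hc : ∀ k, PolyGrowth (c k))
    (hd : ∀ k, PolyGrowth (d k)) :
    HasExpansion δ (fun ε u => f ε u * g ε u) (cauchyProd c d) := by
  obtain ⟨G, hG, hGle⟩ := hg.exists_abs_le hd
  obtain ⟨w, hw, H⟩ := hf
  obtain ⟨w', hw', H'⟩ := hg
  refine ⟨_, ((hw.mul hG).add ((PolyGrowth.sum (range 4) fun k _ => (hc k).abs).mul hw')).add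
    ((((((hc 1).mul (hd 3)).add ((hc 2).mul (hd 2))).add ((hc 3).mul (hd 1))).abs).add
    (((((hc 2).mul (hd 3)).add ((hc 3).mul (hd 2))).abs).add ((hc 3).mul (hd 3)).abs)),
    fun ε h0 h1 u hu => ?_⟩
  have hA := H ε h0 h1 u hu
  have hB := H' ε h0 h1 u hu
  have hC := abs_cauchyProd_truncation_le h0 h1 c d u
  have hS := abs_expansion_sum_le h0 h1 c u
  have hg' := hGle ε h0 h1 u hu
  set S := ∑ k ∈ range 4, ε ^ k * c k u
  set T := ∑ k ∈ range 4, ε ^ k * d k u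
  have e : f ε u * g ε u - ∑ k ∈ range 4, ε ^ k * cauchyProd c d k u =
      (f ε u - S) * g ε u + S * (g ε u - T) +
        (S * T - ∑ k ∈ range 4, ε ^ k * cauchyProd c d k u) := by ring
  have h2 : |(f ε u - S) * g ε u| ≤ ε ^ 4 * w u * G u := by
    rw [abs_mul]
    exact mul_le_mul hA hg' (abs_nonneg _) ((abs_nonneg _).trans hA)
  have h3 : |S * (g ε u - T)| ≤ (∑ k ∈ range 4, |c k u|) * (ε ^ 4 * w' u) := by
    rw [abs_mul]
    exact mul_le_mul hS hB (abs_nonneg _) ((abs_nonneg _).trans hS)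
  rw [e]
  refine (abs_add_le _ _).trans ?_
  have h4 := abs_add_le ((f ε u - S) * g ε u) (S * (g ε u - T))
  rw [mul_add, mul_add]
  linarith

lemma abs_exp_sub_cubic_le (x : ℝ) :
    |exp x - (1 + (x + (1 / 2 * (x * x) + 1 / 6 * (x * (x * x)))))| ≤ |x| ^ 4 * exp |x| := by
  have h := Complex.norm_exp_sub_sum_le_norm_mul_exp (x : ℂ) 4
  have e : Complex.exp (x : ℂ) - ∑ m ∈ range 4, (x : ℂ) ^ m / (m.factorial : ℂ) =
      ((exp x - (1 + (x + (1 / 2 * (x * x) + 1 / 6 * (x * (x * x))))) : ℝ) : ℂ) := by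
    simp [sum_range_succ, Nat.factorial]
    ring
  rw [e, Complex.norm_real, Complex.norm_real, Real.norm_eq_abs, Real.norm_eq_abs] at h
  exact h

/-- Coefficients of `exp ρ` up to order three, for a series `ρ` with coefficients `r` and without
constant term. -/
noncomputable def expCoef (r : ℕ → ℝ × ℝ → ℝ) (k : ℕ) (u : ℝ × ℝ) : ℝ :=
  (if k = 0 then 1 else 0) + (r k u + (1 / 2 * cauchyProd r r k u +
    1 / 6 * cauchyProd r (cauchyProd r r) k u))

lemma polyGrowth_expCoef {r : ℕ → ℝ × ℝ → ℝ} (hr : ∀ k, PolyGrowth (r k)) (k : ℕ) :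
    PolyGrowth (expCoef r k) :=
  (PolyGrowth.const _).add ((hr k).add
    (((PolyGrowth.const _).mul (polyGrowth_cauchyProd hr hr k)).add
    ((PolyGrowth.const _).mul (polyGrowth_cauchyProd hr (polyGrowth_cauchyProd hr hr) k))))

lemma continuous_expCoef {r : ℕ → ℝ × ℝ → ℝ} (hr : ∀ k, Continuous (r k)) (k : ℕ) :
    Continuous (expCoef r k) :=
  continuous_const.add ((hr k).add
    ((continuous_const.mul (continuous_cauchyProd hr hr k)).add
    (continuous_const.mul (continuous_cauchyProd hr (continuous_cauchyProd hr hr) k))))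

lemma expCoef_neg {r : ℕ → ℝ × ℝ → ℝ} (hr : ∀ k u, r k (-u) = (-1) ^ k * r k u) (k : ℕ)
    (u : ℝ × ℝ) : expCoef r k (-u) = (-1) ^ k * expCoef r k u := by
  rw [expCoef, expCoef, hr, cauchyProd_neg hr hr, cauchyProd_neg hr (cauchyProd_neg hr hr)]
  split_ifs with h
  · subst h
    ring
  · ring

/-- The expansion of `exp (-q + ρ) * g`, where `ρ` is small compared with `q` and has no term of
order zero. Half of the decay of `exp (-q)` is spent on the remainder of the exponential series. -/
lemma exists_abs_exp_mul_sub_le {δ : ℝ} {ρ g : ℝ → ℝ × ℝ → ℝ} {r d : ℕ → ℝ × ℝ → ℝ}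
    {q : ℝ × ℝ → ℝ} (hρ : HasExpansion δ ρ r) (hg : HasExpansion δ g d)
    (hr : ∀ k, PolyGrowth (r k)) (hd : ∀ k, PolyGrowth (d k)) (hr0 : ∀ u, r 0 u = 0)
    (hq : ∀ u, 0 ≤ q u)
    (hρq : ∀ ε, 0 < ε → ε ≤ 1 → ∀ u, ε * ‖u‖ < δ → |ρ ε u| ≤ q u / 2) :
    ∃ h, PolyGrowth h ∧ ∀ ε, 0 < ε → ε ≤ 1 → ∀ u, ε * ‖u‖ < δ →
      |exp (-q u + ρ ε u) * g ε u -
        exp (-q u) * ∑ k ∈ range 4, ε ^ k * cauchyProd (expCoef r) d k u| ≤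
      ε ^ 4 * (h u * exp (-(q u / 2))) := by
  have hρ2 := hρ.mul hρ hr hr
  have hρ3 := hρ.mul hρ2 hr (polyGrowth_cauchyProd hr hr)
  have hP : HasExpansion δ (fun ε u => 1 + (ρ ε u + (1 / 2 * (ρ ε u * ρ ε u) +
      1 / 6 * (ρ ε u * (ρ ε u * ρ ε u))))) (expCoef r) :=
    (hasExpansion_const δ fun _ => 1).add
      (hρ.add ((hρ2.const_mul (1 / 2)).add (hρ3.const_mul (1 / 6))))
  obtain ⟨W, hW, HW⟩ := hP.mul hg (polyGrowth_expCoef hr) hd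
  obtain ⟨G, hG, HG⟩ := hg.exists_abs_le hd
  obtain ⟨w, hw, H⟩ := hρ
  -- `ρ` is of order `ε`
  have hV : PolyGrowth fun u => (|r 1 u| + (|r 2 u| + |r 3 u|)) + w u :=
    ((hr 1).abs.add ((hr 2).abs.add (hr 3).abs)).add hw
  have HV : ∀ ε, 0 < ε → ε ≤ 1 → ∀ u, ε * ‖u‖ < δ →
      |ρ ε u| ≤ ε * ((|r 1 u| + (|r 2 u| + |r 3 u|)) + w u) := by
    intro ε h0 h1 u hu
    have h2 := H ε h0 h1 u hu
    have hw0 : 0 ≤ w u :=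
      nonneg_of_mul_nonneg_right ((abs_nonneg _).trans h2) (by positivity)
    have h3 : ε ^ 4 * w u ≤ ε * w u :=
      mul_le_mul_of_nonneg_right (pow_le_of_le_one h0.le h1 (by norm_num)) hw0
    have e : ∑ k ∈ range 4, ε ^ k * r k u = ε * (r 1 u + (ε * r 2 u + ε ^ 2 * r 3 u)) := by
      simp only [sum_range_succ, sum_range_zero, hr0]
      ring
    have h4 : |∑ k ∈ range 4, ε ^ k * r k u| ≤ ε * (|r 1 u| + (|r 2 u| + |r 3 u|)) := by
      rw [e, abs_mul, abs_of_pos h0]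
      refine mul_le_mul_of_nonneg_left ((abs_add_le _ _).trans (add_le_add le_rfl
        ((abs_add_le _ _).trans (add_le_add ?_ ?_)))) h0.le
      · rw [abs_mul, abs_of_pos h0]
        exact mul_le_of_le_one_left (abs_nonneg _) h1
      · rw [abs_mul, abs_of_nonneg (by positivity)]
        exact mul_le_of_le_one_left (abs_nonneg _) (pow_le_one₀ h0.le h1)
    have h5 := abs_sub_abs_le_abs_sub (ρ ε u) (∑ k ∈ range 4, ε ^ k * r k u)
    rw [mul_add]
    linarith
  refine ⟨_, ((hV.mul hV).mul (hV.mul hV)).mul hG |>.add hW, fun ε h0 h1 u hu => ?_⟩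
  have hx := HV ε h0 h1 u hu
  have hgG := HG ε h0 h1 u hu
  have hWu := HW ε h0 h1 u hu
  have hρu := hρq ε h0 h1 u hu
  set V := (|r 1 u| + (|r 2 u| + |r 3 u|)) + w u
  set x := ρ ε u
  set P := 1 + (x + (1 / 2 * (x * x) + 1 / 6 * (x * (x * x)))) with hPdef
  set T := ∑ k ∈ range 4, ε ^ k * cauchyProd (expCoef r) d k u
  have hG0 : 0 ≤ G u := (abs_nonneg _).trans hgG
  have hVV : 0 ≤ ε ^ 4 * (V * V * (V * V)) :=
    mul_nonneg (by positivity) (mul_self_nonneg _)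
  have hx4 : |x| ^ 4 ≤ ε ^ 4 * (V * V * (V * V)) := by
    calc |x| ^ 4 ≤ (ε * V) ^ 4 := pow_le_pow_left₀ (abs_nonneg _) hx 4
      _ = _ := by ring
  have hW0 : 0 ≤ W u :=
    nonneg_of_mul_nonneg_right ((abs_nonneg _).trans hWu) (by positivity)
  have h2 : |exp (-q u) * (exp x - P) * g ε u| ≤
      ε ^ 4 * (V * V * (V * V)) * G u * exp (-(q u / 2)) := by
    rw [abs_mul, abs_mul, abs_of_pos (exp_pos _)]
    calc exp (-q u) * |exp x - P| * |g ε u|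
        ≤ exp (-q u) * (ε ^ 4 * (V * V * (V * V)) * exp (q u / 2)) * G u := by
          refine mul_le_mul (mul_le_mul_of_nonneg_left ((abs_exp_sub_cubic_le x).trans ?_)
            (exp_pos _).le) hgG (abs_nonneg _)
            (mul_nonneg (exp_pos _).le (mul_nonneg hVV (exp_pos _).le))
          exact mul_le_mul hx4 (exp_le_exp.mpr hρu) (exp_pos _).le hVV
      _ = ε ^ 4 * (V * V * (V * V)) * G u * (exp (-q u) * exp (q u / 2)) := by ring
      _ = _ := by
        rw [← exp_add]
        ring_nf
  have h3 : |exp (-q u) * (P * g ε u - T)| ≤ exp (-(q u / 2)) * (ε ^ 4 * W u) := by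
    rw [abs_mul, abs_of_pos (exp_pos _)]
    refine mul_le_mul (exp_le_exp.mpr ?_) hWu (abs_nonneg _) (exp_pos _).le
    linarith [hq u]
  have e : exp (-q u + x) * g ε u - exp (-q u) * T =
      exp (-q u) * (exp x - P) * g ε u + exp (-q u) * (P * g ε u - T) := by
    rw [exp_add]
    ring
  rw [e]
  refine (abs_add_le _ _).trans ((add_le_add h2 h3).trans_eq ?_)
  ring

/-- Rescaled Taylor expansion around `p`, after division by `ε ^ s`. -/
lemma exists_hasExpansion_taylor {f : ℝ × ℝ → ℝ} {p : ℝ × ℝ} (hf : AnalyticAt ℝ f p) (s : ℕ) :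
    ∃ δ > 0, HasExpansion δ
      (fun ε u => (f (p + ε • u) - ∑ j ∈ range s, taylorHom f p j (ε • u)) / ε ^ s)
      (fun k => taylorHom f p (s + k)) := by
  obtain ⟨C, hC⟩ := (taylor_isBigO hf (s + 4)).bound
  obtain ⟨δ, hδ, hball⟩ := Metric.eventually_nhds_iff_ball.mp hC
  refine ⟨δ, hδ, _, (PolyGrowth.const C).mul (polyGrowth_norm_pow (s + 4)),
    fun ε h0 h1 u hu => ?_⟩
  have h := hball (ε • u) (by simpa [norm_smul, abs_of_pos h0] using hu)
  rw [norm_pow, norm_norm, norm_smul, Real.norm_of_nonneg h0.le, sum_range_add,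
    Real.norm_eq_abs, ← sub_sub] at h
  have e : (f (p + ε • u) - ∑ j ∈ range s, taylorHom f p j (ε • u)) / ε ^ s -
      ∑ k ∈ range 4, ε ^ k * taylorHom f p (s + k) u =
      (f (p + ε • u) - ∑ j ∈ range s, taylorHom f p j (ε • u) -
        ∑ k ∈ range 4, taylorHom f p (s + k) (ε • u)) / ε ^ s := by
    rw [sub_div _ (∑ k ∈ range 4, _), sum_div]
    congr 1
    refine sum_congr rfl fun k _ => ?_
    rw [taylorHom_smul, pow_add]
    field_simp
  rw [e, abs_div, abs_of_pos (pow_pos h0 s), div_le_iff₀ (pow_pos h0 s)]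
  refine h.trans_eq ?_
  rw [mul_pow, pow_add ε]
  ring

lemma taylorHom_neg (f : ℝ × ℝ → ℝ) (p : ℝ × ℝ) (n : ℕ) (z : ℝ × ℝ) :
    taylorHom f p n (-z) = (-1) ^ n * taylorHom f p n z := by
  rw [← taylorHom_smul, neg_one_smul]

/-- The Gaussian part of Laplace's method, in coordinates rescaled by `ε`: the terms of odd order
in `ε` vanish by symmetry. Outside of `ε * ‖u‖ < δ`, one has `1 ≤ (ε * ‖u‖ / δ) ^ 4`, so there the
approximating polynomial is itself of the order of the error. -/
theorem exists_abs_integral_sub_gaussAvg_le {α β γ δ : ℝ} (hα : 0 < α) (hD : 0 < α * γ - β ^ 2)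
    (hδ : 0 < δ) {ρ g : ℝ → ℝ × ℝ → ℝ} {r d : ℕ → ℝ × ℝ → ℝ}
    (hρ : HasExpansion δ ρ r) (hg : HasExpansion δ g d)
    (hr : ∀ k, PolyGrowth (r k)) (hd : ∀ k, PolyGrowth (d k))
    (hrc : ∀ k, Continuous (r k)) (hdc : ∀ k, Continuous (d k))
    (hrn : ∀ k u, r k (-u) = (-1) ^ k * r k u) (hdn : ∀ k u, d k (-u) = (-1) ^ k * d k u)
    (hr0 : ∀ u, r 0 u = 0)
    (hρq : ∀ ε, 0 < ε → ε ≤ 1 → ∀ u, ε * ‖u‖ < δ → |ρ ε u| ≤ quad α β γ u / 2) :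
    ∃ C, ∀ ε, 0 < ε → ε ≤ 1 →
      Integrable ({u | ε * ‖u‖ < δ}.indicator
        fun u => exp (-quad α β γ u + ρ ε u) * g ε u) →
      |√(α * γ - β ^ 2) / (2 * π) * (∫ u, {u | ε * ‖u‖ < δ}.indicator
          (fun u => exp (-quad α β γ u + ρ ε u) * g ε u) u) -
        (gaussAvg α β γ (cauchyProd (expCoef r) d 0) +
          ε ^ 2 * gaussAvg α β γ (cauchyProd (expCoef r) d 2))| ≤ C * ε ^ 4 := by
  obtain ⟨l, hl, hlq⟩ := exists_mul_norm_sq_le_quad hα hD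
  have hq0 : ∀ u, 0 ≤ quad α β γ u := fun u => le_trans (by positivity) (hlq u)
  obtain ⟨h, hh, H⟩ := exists_abs_exp_mul_sub_le hρ hg hr hd hr0 hq0 hρq
  set T := cauchyProd (expCoef r) d with hT
  have hTg : ∀ k, PolyGrowth (T k) := polyGrowth_cauchyProd (polyGrowth_expCoef hr) hd
  have hTc : ∀ k, Continuous (T k) := continuous_cauchyProd (continuous_expCoef hrc) hdc
  have hTn : ∀ k u, T k (-u) = (-1) ^ k * T k u := cauchyProd_neg (expCoef_neg hrn) hdn
  obtain ⟨c, m, hcm⟩ := hh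
  have hsumc : Continuous fun u => ∑ k ∈ range 4, |T k u| :=
    continuous_finsetSum _ fun k _ => (hTc k).abs
  have hsumg : PolyGrowth fun u => ∑ k ∈ range 4, |T k u| :=
    PolyGrowth.sum _ fun k _ => (hTg k).abs
  -- an integrable majorant of the error: the first summand serves inside the region
  -- `ε * ‖u‖ < δ`, the second one outside
  set W : ℝ × ℝ → ℝ := fun u => c * ((1 + ‖u‖) ^ m * exp (-(l / 2 * ‖u‖ ^ 2))) +
    exp (-quad α β γ u) * ((δ ^ 4)⁻¹ * (‖u‖ ^ 4 * ∑ k ∈ range 4, |T k u|)) with hW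
  have hWint : Integrable W := by
    refine ((integrable_pow_mul_exp (half_pos hl) m).const_mul c).add
      (integrable_exp_neg_quad_mul hα hD ?_ ?_)
    · exact continuous_const.mul ((continuous_norm.pow 4).mul hsumc)
    · exact (PolyGrowth.const _).mul ((polyGrowth_norm_pow 4).mul hsumg)
  have hd0 : 0 ≤ √(α * γ - β ^ 2) / (2 * π) := by positivity
  refine ⟨√(α * γ - β ^ 2) / (2 * π) * ∫ u, W u, fun ε h0 h1 hint => ?_⟩
  set Ψ := {u : ℝ × ℝ | ε * ‖u‖ < δ}.indicator
    fun u => exp (-quad α β γ u + ρ ε u) * g ε u with hΨ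
  set S : ℝ × ℝ → ℝ := fun u => exp (-quad α β γ u) * ∑ k ∈ range 4, ε ^ k * T k u with hS
  have hSint : Integrable S :=
    integrable_exp_neg_quad_mul hα hD
      (continuous_finsetSum _ fun k _ => continuous_const.mul (hTc k))
      (PolyGrowth.sum _ fun k _ => (PolyGrowth.const _).mul (hTg k))
  have hSavg : √(α * γ - β ^ 2) / (2 * π) * ∫ u, S u =
      gaussAvg α β γ (T 0) + ε ^ 2 * gaussAvg α β γ (T 2) := by
    have e : √(α * γ - β ^ 2) / (2 * π) * ∫ u, S u =
        gaussAvg α β γ (fun u => ∑ k ∈ range 4, ε ^ k * T k u) := rfl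
    rw [e, gaussAvg_sum hα hD _ (h := fun k u => ε ^ k * T k u)
      (fun k _ => continuous_const.mul (hTc k))
      (fun k _ => (PolyGrowth.const _).mul (hTg k))]
    simp only [gaussAvg_const_mul, sum_range_succ, sum_range_zero]
    rw [gaussAvg_odd α β γ (h := T 1) (fun u => by rw [hTn]; ring),
      gaussAvg_odd α β γ (h := T 3) (fun u => by rw [hTn]; ring)]
    ring
  have hpt : ∀ u, ‖Ψ u - S u‖ ≤ ε ^ 4 * W u := by
    intro u
    have hsum0 : 0 ≤ ∑ k ∈ range 4, |T k u| := sum_nonneg fun k _ => abs_nonneg _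
    rw [Real.norm_eq_abs]
    by_cases hu : ε * ‖u‖ < δ
    · have hΨu : Ψ u = exp (-quad α β γ u + ρ ε u) * g ε u :=
        Set.indicator_of_mem (s := {u : ℝ × ℝ | ε * ‖u‖ < δ}) hu _
      rw [hΨu]
      refine (H ε h0 h1 u hu).trans (mul_le_mul_of_nonneg_left ?_ (by positivity))
      have h2 : h u * exp (-(quad α β γ u / 2)) ≤
          c * ((1 + ‖u‖) ^ m * exp (-(l / 2 * ‖u‖ ^ 2))) := by
        rw [← mul_assoc]
        refine mul_le_mul ((le_abs_self _).trans (hcm u)) (exp_le_exp.mpr ?_) (exp_pos _).le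
          ((abs_nonneg _).trans (hcm u))
        linarith [hlq u]
      have h3 : 0 ≤ exp (-quad α β γ u) *
          ((δ ^ 4)⁻¹ * (‖u‖ ^ 4 * ∑ k ∈ range 4, |T k u|)) := by positivity
      simp only [hW]
      linarith
    · have hΨu : Ψ u = 0 := 
        Set.indicator_of_notMem (s := {u : ℝ × ℝ | ε * ‖u‖ < δ}) hu _
      rw [hΨu, zero_sub, abs_neg, hS, abs_mul, abs_of_pos (exp_pos _)]
      have hc0 := nonneg_of_abs_le_mul_pow (norm_nonneg u) (hcm u)
      have h2 : 1 ≤ ε ^ 4 * ((δ ^ 4)⁻¹ * ‖u‖ ^ 4) := by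
        have : 1 ≤ ε * ‖u‖ / δ := (one_le_div hδ).mpr (not_lt.mp hu)
        calc (1 : ℝ) ≤ (ε * ‖u‖ / δ) ^ 4 := one_le_pow₀ this
          _ = _ := by ring
      have h3 : |∑ k ∈ range 4, ε ^ k * T k u| ≤
          ε ^ 4 * ((δ ^ 4)⁻¹ * ‖u‖ ^ 4) * ∑ k ∈ range 4, |T k u| :=
        (abs_expansion_sum_le h0 h1 T u).trans (le_mul_of_one_le_left hsum0 h2)
      have h4 : 0 ≤ ε ^ 4 * (c * ((1 + ‖u‖) ^ m * exp (-(l / 2 * ‖u‖ ^ 2)))) := by positivity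
      have h5 := mul_le_mul_of_nonneg_left h3 (exp_pos (-quad α β γ u)).le
      simp only [hW]
      rw [mul_add]
      refine h5.trans ((le_add_of_nonneg_left h4).trans_eq ?_)
      ring
  rw [← hSavg, ← mul_sub, ← integral_sub hint hSint, abs_mul, abs_of_nonneg hd0, mul_assoc,
    mul_comm _ (ε ^ 4), ← integral_const_mul]
  exact mul_le_mul_of_nonneg_left
    (norm_integral_le_of_norm_le (hWint.const_mul _) (Eventually.of_forall hpt)) hd0

/-! ### The function `Φ` -/

@[fun_prop]
lemma continuous_Phi (a b : ℝ) : Continuous (Phi a b) := by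
  unfold Phi
  fun_prop

lemma analyticAt_Phi (a b : ℝ) (p : ℝ × ℝ) : AnalyticAt ℝ (Phi a b) p := by
  have h : ContDiff ℝ ⊤ (Phi a b) := by
    unfold Phi
    fun_prop
  exact h.contDiffAt.analyticAt

/-- Half of each exponent absorbs the factors `x` and `exp (a y + b)`. -/
lemma exists_abs_Phi_le {a : ℝ} (ha : 0 < a) (b : ℝ) :
    ∃ c > 0, ∃ l > 0, ∀ q, |Phi a b q| ≤ c * exp (-(l * ‖q‖ ^ 2)) := by
  -- `|x| ≤ exp (1 + x² / 4)` and `a y ≤ a (1 + y² / 4)`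
  refine ⟨exp 1 + exp (a + b), by positivity, min (1 / 4) (a / 4), by positivity, fun q => ?_⟩
  obtain ⟨x, y⟩ := q
  have h1 : |x| ≤ exp 1 * exp (x ^ 2 / 4 + a * y ^ 2 / 4) := by
    rw [← exp_add]
    refine (by linarith [add_one_le_exp |x|] : |x| ≤ exp |x|).trans (exp_le_exp.mpr ?_)
    have : 0 ≤ a * y ^ 2 / 4 := by positivity
    nlinarith [sq_nonneg (|x| - 2), sq_abs x]
  have h2 : exp (a * y + b) ≤ exp (a + b) * exp (x ^ 2 / 4 + a * y ^ 2 / 4) := by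
    rw [← exp_add]
    refine exp_le_exp.mpr ?_
    have : 0 ≤ a * (y - 2) ^ 2 / 4 := by positivity
    nlinarith [sq_nonneg x]
  have h3 : |x + exp (a * y + b)| ≤
      (exp 1 + exp (a + b)) * exp (x ^ 2 / 4 + a * y ^ 2 / 4) := by
    refine (abs_add_le _ _).trans ?_
    rw [abs_of_pos (exp_pos (a * y + b)), add_mul]
    exact add_le_add h1 h2
  have h4 : min (1 / 4) (a / 4) * ‖((x, y) : ℝ × ℝ)‖ ^ 2 ≤ x ^ 2 / 4 + a * y ^ 2 / 4 := by
    rw [Prod.norm_def, Real.norm_eq_abs, Real.norm_eq_abs]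
    rcases le_total |x| |y| with h | h
    · rw [max_eq_right h, sq_abs]
      nlinarith [mul_le_mul_of_nonneg_right (min_le_right (1 / 4) (a / 4)) (sq_nonneg y),
        sq_nonneg x]
    · rw [max_eq_left h, sq_abs]
      have : 0 ≤ a * y ^ 2 / 4 := by positivity
      nlinarith [mul_le_mul_of_nonneg_right (min_le_left (1 / 4) (a / 4)) (sq_nonneg x)]
  rw [Phi, abs_mul, abs_of_pos (exp_pos _)]
  calc |x + exp (a * y + b)| * exp (-(x ^ 2) / 2 - a * y ^ 2 / 2)
      ≤ (exp 1 + exp (a + b)) * exp (x ^ 2 / 4 + a * y ^ 2 / 4) *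
        exp (-(x ^ 2) / 2 - a * y ^ 2 / 2) := mul_le_mul_of_nonneg_right h3 (exp_pos _).le
    _ = (exp 1 + exp (a + b)) * exp (-(x ^ 2 / 4 + a * y ^ 2 / 4)) := by
      rw [mul_assoc, ← exp_add]
      ring_nf
    _ ≤ _ := by gcongr

lemma Phi_pos_of_max {a b : ℝ} {p : ℝ × ℝ} (hmax : ∀ q, Phi a b q ≤ Phi a b p) :
    0 < Phi a b p := by
  refine lt_of_lt_of_le ?_ (hmax (0, 0))
  simp [Phi, exp_pos]

lemma integrable_Phi_pow {a b : ℝ} (ha : 0 < a) {N : ℕ} (hN : 1 ≤ N) :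
    Integrable fun q => Phi a b q ^ N := by
  obtain ⟨c, hc, l, hl, h⟩ := exists_abs_Phi_le ha b
  have hl' : 0 < N * l := by positivity
  refine ((integrable_exp_neg_mul_norm_sq hl').const_mul (c ^ N)).mono'
    ((continuous_Phi a b).pow N).aestronglyMeasurable (Eventually.of_forall fun q => ?_)
  rw [norm_pow, Real.norm_eq_abs]
  refine (pow_le_pow_left₀ (abs_nonneg _) (h q) N).trans_eq ?_
  rw [mul_pow, ← exp_nat_mul]
  ring_nf

/-- Where `Φ` is negative, it is beaten by its value at the point reflected in the `y`-axis. -/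
lemma abs_Phi_lt_of_ne {a b : ℝ} {p q : ℝ × ℝ} (hmax : IsUniqueGlobalMax (Phi a b) p)
    (hq : q ≠ p) : |Phi a b q| < Phi a b p := by
  obtain ⟨hm, hu⟩ := hmax
  rcases le_or_gt 0 (Phi a b q) with h | h
  · rw [abs_of_nonneg h]
    refine lt_of_le_of_ne (hm q) fun he => hq (hu q fun q' => he ▸ hm q')
  · rw [abs_of_neg h]
    refine lt_of_lt_of_le ?_ (hm (-q.1, q.2))
    simp only [Phi, neg_sq]
    rw [← neg_mul]
    refine mul_lt_mul_of_pos_right ?_ (exp_pos _)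
    linarith [exp_pos (a * q.2 + b)]

/-- Away from the maximum point, `|Φ|` stays below a fixed proportion of the maximum. -/
lemma exists_abs_Phi_le_mul {a b : ℝ} (ha : 0 < a) {p : ℝ × ℝ}
    (hmax : IsUniqueGlobalMax (Phi a b) p) {δ : ℝ} (hδ : 0 < δ) :
    ∃ η, 0 < η ∧ η < 1 ∧ ∀ q, q ∉ Metric.ball p δ → |Phi a b q| ≤ η * Phi a b p := by
  have hpos := Phi_pos_of_max hmax.1
  obtain ⟨c, hc, l, hl, h⟩ := exists_abs_Phi_le ha b
  have hlim : Tendsto (fun q => |Phi a b q|) (cocompact (ℝ × ℝ)) (𝓝 0) := by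
    have h1 : Tendsto (fun q : ℝ × ℝ => c * exp (-(l * ‖q‖ ^ 2))) (cocompact (ℝ × ℝ))
        (𝓝 (c * 0)) := by
      refine Tendsto.const_mul c (tendsto_exp_neg_atTop_nhds_zero.comp ?_)
      exact ((tendsto_pow_atTop two_ne_zero).comp (tendsto_norm_cocompact_atTop)).const_mul_atTop hl
    rw [mul_zero] at h1
    exact squeeze_zero (fun q => abs_nonneg _) h h1
  obtain ⟨K, hK, hKc⟩ := mem_cocompact.mp (hlim.eventually (gt_mem_nhds (half_pos hpos)))
  have hKb : IsCompact (K \ Metric.ball p δ) := hK.diff Metric.isOpen_ball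
  have hfar : ∀ q, q ∉ K → |Phi a b q| ≤ 1 / 2 * Phi a b p := fun q hq => by
    have : |Phi a b q| < Phi a b p / 2 := hKc hq
    linarith
  rcases (K \ Metric.ball p δ).eq_empty_or_nonempty with he | hne
  · refine ⟨1 / 2, by norm_num, by norm_num, fun q hq => hfar q fun hqK => ?_⟩
    exact Set.notMem_empty q (he ▸ ⟨hqK, hq⟩)
  · obtain ⟨q₀, hq₀, hq₀m⟩ := hKb.exists_isMaxOn hne (f := fun q => |Phi a b q|)
      (by fun_prop)
    have hq₀p : q₀ ≠ p := fun he => hq₀.2 (he ▸ Metric.mem_ball_self hδ)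
    refine ⟨max (1 / 2) (|Phi a b q₀| / Phi a b p), by positivity, max_lt (by norm_num) ?_,
      fun q hq => ?_⟩
    · rw [div_lt_one hpos]
      exact abs_Phi_lt_of_ne hmax hq₀p
    · by_cases hqK : q ∈ K
      · refine (hq₀m ⟨hqK, hq⟩ : |Phi a b q| ≤ |Phi a b q₀|).trans ?_
        rw [← div_le_iff₀ hpos]
        exact le_max_right _ _
      · refine (hfar q hqK).trans ?_
        gcongr
        exact le_max_left _ _

/-- The part of the integral away from the maximum point is exponentially small relative to
`Φ(p) ^ N`. -/
lemma exists_abs_tail_le {a b : ℝ} (ha : 0 < a) {p : ℝ × ℝ}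
    (hmax : IsUniqueGlobalMax (Phi a b) p) {G : ℝ × ℝ → ℝ}
    (hG : ∀ᶠ N : ℕ in atTop, Integrable (fun q => Phi a b q ^ N * G q)) {δ : ℝ} (hδ : 0 < δ) :
    ∃ η C, 0 < η ∧ η < 1 ∧ ∀ᶠ N : ℕ in atTop,
      |∫ q in (Metric.ball p δ)ᶜ, Phi a b q ^ N * G q| ≤ C * η ^ N * Phi a b p ^ N := by
  have hpos := Phi_pos_of_max hmax.1
  obtain ⟨η, hη0, hη1, hη⟩ := exists_abs_Phi_le_mul ha hmax hδ
  obtain ⟨M, hM⟩ := eventually_atTop.mp hG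
  have hMi := hM M le_rfl
  refine ⟨η, (η * Phi a b p)⁻¹ ^ M * ∫ q in (Metric.ball p δ)ᶜ, ‖Phi a b q ^ M * G q‖,
    hη0, hη1, ?_⟩
  filter_upwards [eventually_ge_atTop M] with N hN
  obtain ⟨k, rfl⟩ := Nat.exists_eq_add_of_le hN
  have hb : ∀ᵐ q ∂(volume.restrict (Metric.ball p δ)ᶜ), ‖Phi a b q ^ (M + k) * G q‖ ≤
      (η * Phi a b p) ^ k * ‖Phi a b q ^ M * G q‖ := by
    refine (ae_restrict_iff' Metric.isOpen_ball.measurableSet.compl).mpr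
      (Eventually.of_forall fun q hq => ?_)
    rw [pow_add, mul_right_comm, norm_mul, mul_comm, norm_pow (Phi a b q) k, Real.norm_eq_abs]
    exact mul_le_mul_of_nonneg_right (pow_le_pow_left₀ (abs_nonneg _) (hη q hq) k) (norm_nonneg _)
  have := norm_integral_le_of_norm_le (hMi.norm.restrict.const_mul _) hb
  rw [integral_const_mul, Real.norm_eq_abs] at this
  refine this.trans_eq ?_
  have h1 : η * Phi a b p ≠ 0 := by positivity
  rw [mul_assoc, ← mul_pow, pow_add, inv_pow]
  field_simp

/-! ### The normalised integral -/

lemma analyticAt_F {a b : ℝ} {p : ℝ × ℝ} (hp : 0 < Phi a b p) : AnalyticAt ℝ (F a b) p :=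
  ((analyticAt_Phi a b p).contDiffAt.log hp.ne').analyticAt

lemma exp_F {a b : ℝ} {q : ℝ × ℝ} (hq : 0 < Phi a b q) : exp (F a b q) = Phi a b q :=
  exp_log hq

lemma eventually_Phi_pos {a b : ℝ} {p : ℝ × ℝ} (hp : 0 < Phi a b p) :
    ∀ᶠ q in 𝓝 p, 0 < Phi a b q :=
  (continuous_Phi a b).continuousAt.eventually (lt_mem_nhds hp)

lemma isLocalMax_F {a b : ℝ} {p : ℝ × ℝ} (hmax : ∀ q, Phi a b q ≤ Phi a b p) :
    IsLocalMax (F a b) p := by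
  filter_upwards [eventually_Phi_pos (Phi_pos_of_max hmax)] with q hq
  exact log_le_log hq (hmax q)

lemma taylorHom_F_one {a b : ℝ} {p : ℝ × ℝ} (hmax : ∀ q, Phi a b q ≤ Phi a b p) (z : ℝ × ℝ) :
    taylorHom (F a b) p 1 z = 0 := by
  have hloc := isLocalMax_F hmax
  have hx : pderiv (F a b) p 1 0 = 0 := by
    have hc : ContinuousAt (fun x : ℝ => (x, p.2)) p.1 := by fun_prop
    have : IsLocalMax (fun x => F a b (x, p.2)) p.1 := hc.eventually hloc
    simpa [pderiv] using this.deriv_eq_zero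
  have hy : pderiv (F a b) p 0 1 = 0 := by
    have hc : ContinuousAt (fun y : ℝ => (p.1, y)) p.2 := by fun_prop
    have : IsLocalMax (fun y => F a b (p.1, y)) p.2 := hc.eventually hloc
    simpa [pderiv] using this.deriv_eq_zero
  simp [taylorHom, Nat.sum_antidiagonal_succ, coef, hx, hy]

/-- The quadratic form `½ uᵀ (-Hess F(p)) u`. -/
noncomputable def peakQuad (a b : ℝ) (p : ℝ × ℝ) : ℝ × ℝ → ℝ :=
  quad (-pderiv (F a b) p 2 0) (-pderiv (F a b) p 1 1) (-pderiv (F a b) p 0 2)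

/-- The expectation under the centred Gaussian law with covariance matrix `C = (-Hess F(p))⁻¹`. -/
noncomputable def peakAvg (a b : ℝ) (p : ℝ × ℝ) : (ℝ × ℝ → ℝ) → ℝ :=
  gaussAvg (-pderiv (F a b) p 2 0) (-pderiv (F a b) p 1 1) (-pderiv (F a b) p 0 2)

/-- The coefficient of `ε ^ k` in `ε⁻² * (F(p + ε u) - F(p)) + ½ uᵀ (-Hess F(p)) u`, for a
critical point `p` of `F`. -/
noncomputable def logCoef (a b : ℝ) (p : ℝ × ℝ) (k : ℕ) (u : ℝ × ℝ) : ℝ :=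
  if k = 0 then 0 else taylorHom (F a b) p (2 + k) u

lemma taylorHom_F_two (a b : ℝ) (p z : ℝ × ℝ) :
    taylorHom (F a b) p 2 z = -peakQuad a b p z := by
  simp [taylorHom, Nat.sum_antidiagonal_succ, coef, peakQuad, quad]
  ring

lemma polyGrowth_logCoef (a b : ℝ) (p : ℝ × ℝ) (k : ℕ) : PolyGrowth (logCoef a b p k) := by
  unfold logCoef
  split_ifs
  · exact PolyGrowth.const 0
  · exact polyGrowth_taylorHom _ _ _

lemma continuous_taylorHom (f : ℝ × ℝ → ℝ) (p : ℝ × ℝ) (n : ℕ) : Continuous (taylorHom f p n) :=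
  (contDiff_taylorHom f p n).continuous

lemma continuous_logCoef (a b : ℝ) (p : ℝ × ℝ) (k : ℕ) : Continuous (logCoef a b p k) := by
  unfold logCoef
  split_ifs
  · exact continuous_const
  · exact continuous_taylorHom _ _ _

lemma logCoef_neg (a b : ℝ) (p : ℝ × ℝ) (k : ℕ) (u : ℝ × ℝ) :
    logCoef a b p k (-u) = (-1) ^ k * logCoef a b p k u := by
  unfold logCoef
  split_ifs
  · simp
  · rw [taylorHom_neg, pow_add]
    simp

lemma neg_pderiv_two_pos {a b : ℝ} {p : ℝ × ℝ} (hhess : (-hess (F a b) p).PosDef) :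
    0 < -pderiv (F a b) p 2 0 := by
  simpa [hess] using hhess.diag_pos (i := 0)

lemma D_eq (a b : ℝ) (p : ℝ × ℝ) : D a b p =
    -pderiv (F a b) p 2 0 * -pderiv (F a b) p 0 2 - (-pderiv (F a b) p 1 1) ^ 2 := by
  simp [D, hess, Matrix.det_fin_two]
  ring

lemma D_pos {a b : ℝ} {p : ℝ × ℝ} (hhess : (-hess (F a b) p).PosDef) : 0 < D a b p :=
  hhess.det_pos

/-- The exponent `N * (F - F(p))`, with `N = ε⁻²`, in coordinates rescaled by `ε`: its expansion
beyond the quadratic term, and its domination by that term. -/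
lemma exists_logRemainder {a b : ℝ} {p : ℝ × ℝ} (hmax : ∀ q, Phi a b q ≤ Phi a b p)
    (hhess : (-hess (F a b) p).PosDef) :
    ∃ δ > 0, HasExpansion δ
        (fun ε u => (F a b (p + ε • u) - F a b p) / ε ^ 2 + peakQuad a b p u) (logCoef a b p) ∧
      ∀ ε, 0 < ε → ∀ u, ε * ‖u‖ < δ →
        |(F a b (p + ε • u) - F a b p) / ε ^ 2 + peakQuad a b p u| ≤ peakQuad a b p u / 2 := by
  have hF := analyticAt_F (Phi_pos_of_max hmax)
  obtain ⟨δ₁, hδ₁, hexp⟩ := exists_hasExpansion_taylor hF 2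
  obtain ⟨l, hl, hlq⟩ := exists_mul_norm_sq_le_quad (neg_pderiv_two_pos hhess)
    (D_eq a b p ▸ D_pos hhess)
  obtain ⟨C, hC⟩ := (taylor_isBigO hF 3).bound
  obtain ⟨δ₂, hδ₂, hball⟩ := Metric.eventually_nhds_iff_ball.mp hC
  have hδ₃ : 0 < l / (2 * (|C| + 1)) := by positivity
  refine ⟨min δ₁ (min δ₂ (l / (2 * (|C| + 1)))), by positivity, ?_, fun ε h0 u hu => ?_⟩
  · have h := (hexp.anti (min_le_left δ₁ (min δ₂ (l / (2 * (|C| + 1)))))).add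
      (hasExpansion_const _ (peakQuad a b p))
    convert h using 3 with ε u k u
    · simp [sum_range_succ, taylorHom_zero, taylorHom_F_one hmax]
    · rcases Nat.eq_zero_or_pos k with rfl | hk
      · simp [logCoef, taylorHom_F_two]
      · simp [logCoef, hk.ne']
  · have hu2 : ε * ‖u‖ < δ₂ := hu.trans_le ((min_le_right _ _).trans (min_le_left _ _))
    have hu3 : ε * ‖u‖ < l / (2 * (|C| + 1)) :=
      hu.trans_le ((min_le_right _ _).trans (min_le_right _ _))
    have h := hball (ε • u) (by simpa [norm_smul, abs_of_pos h0] using hu2)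
    have e : F a b (p + ε • u) - ∑ j ∈ range 3, taylorHom (F a b) p j (ε • u) =
        ε ^ 2 * ((F a b (p + ε • u) - F a b p) / ε ^ 2 + peakQuad a b p u) := by
      have h2 : peakQuad a b p (ε • u) = ε ^ 2 * peakQuad a b p u := quad_smul _ _ _ ε u
      simp only [sum_range_succ, sum_range_zero, taylorHom_zero, taylorHom_F_one hmax,
        taylorHom_F_two, h2]
      field_simp
      ring
    rw [e, norm_mul, norm_pow, norm_pow, norm_norm, norm_smul, Real.norm_of_nonneg h0.le,
      Real.norm_eq_abs] at h
    have h3 : |(F a b (p + ε • u) - F a b p) / ε ^ 2 + peakQuad a b p u| ≤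
        C * (ε * ‖u‖) * ‖u‖ ^ 2 := by
      refine le_of_mul_le_mul_left (h.trans_eq ?_) (pow_pos h0 2)
      ring
    have h4 : C * (ε * ‖u‖) ≤ l / 2 := by
      calc C * (ε * ‖u‖) ≤ (|C| + 1) * (l / (2 * (|C| + 1))) := by
            refine mul_le_mul ?_ hu3.le (by positivity) (by positivity)
            linarith [le_abs_self C]
        _ = l / 2 := by field_simp
    have h5 : l * ‖u‖ ^ 2 ≤ peakQuad a b p u := hlq u
    have h6 := mul_le_mul_of_nonneg_right h4 (sq_nonneg ‖u‖)
    linarith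

lemma integral_eq_integral_rescaled (f : ℝ × ℝ → ℝ) (p : ℝ × ℝ) {ε : ℝ} (h0 : 0 < ε) :
    ∫ q, f q = ε ^ 2 * ∫ u, f (p + ε • u) := by
  rw [integral_comp_smul_plane (fun v => f (p + v)), integral_add_left_eq_self f p]
  field_simp

lemma integrable_rescaled {f : ℝ × ℝ → ℝ} (hf : Integrable f) (p : ℝ × ℝ) {ε : ℝ} (h0 : 0 < ε) :
    Integrable fun u => f (p + ε • u) :=
  (hf.comp_add_left p).comp_smul h0.ne'

lemma add_smul_mem_ball {p u : ℝ × ℝ} {ε δ : ℝ} (h0 : 0 < ε) :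
    p + ε • u ∈ Metric.ball p δ ↔ ε * ‖u‖ < δ := by
  simp [norm_smul, abs_of_pos h0]

lemma tendsto_norm_mul_geometric {η : ℝ} (h0 : 0 < η) (h1 : η < 1) (n : ℕ) :
    ∀ᶠ N : ℕ in atTop, (N : ℝ) * η ^ N ≤ ((N : ℝ) ^ n)⁻¹ := by
  filter_upwards [(tendsto_pow_const_mul_const_pow_of_lt_one (n + 1) h0.le h1).eventually
    (gt_mem_nhds one_pos), eventually_ge_atTop 1] with N hN h1N
  have hpos : (0 : ℝ) < N := by exact_mod_cast h1N
  rw [← one_div, le_div_iff₀ (by positivity)]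
  refine le_trans (le_of_eq ?_) hN.le
  ring

/-- Laplace's expansion of `I'_N(G)` to two terms, for `G` vanishing to the even order `2 * m` at
the maximum point: the expectations are those of the coefficients of order `0` and `2` in `ε` of
the product of `exp` of the rescaled higher terms of `F` and of `ε⁻²ᵐ G(p + ε u)`. -/
theorem laplace_expansion {a b : ℝ} (ha : 0 < a) {p : ℝ × ℝ}
    (hmax : IsUniqueGlobalMax (Phi a b) p) (hhess : (-hess (F a b) p).PosDef)
    {G : ℝ × ℝ → ℝ} (hG : AnalyticAt ℝ G p)
    (hint : ∀ᶠ N : ℕ in atTop, Integrable (fun q => Phi a b q ^ N * G q)) (m : ℕ)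
    (hvan : ∀ j < 2 * m, ∀ z, taylorHom G p j z = 0) :
    (fun N : ℕ => I' a b p G N - ((N : ℝ) ^ m)⁻¹ *
      (peakAvg a b p (cauchyProd (expCoef (logCoef a b p))
          (fun k => taylorHom G p (2 * m + k)) 0) +
        (N : ℝ)⁻¹ * peakAvg a b p (cauchyProd (expCoef (logCoef a b p))
          (fun k => taylorHom G p (2 * m + k)) 2)))
      =O[atTop] fun N : ℕ => ((N : ℝ) ^ (m + 2))⁻¹ := by
  have hpos := Phi_pos_of_max hmax.1
  have hD := D_pos hhess
  obtain ⟨δ₁, hδ₁, hρ, hρq⟩ := exists_logRemainder hmax.1 hhess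
  obtain ⟨δ₂, hδ₂, hg⟩ := exists_hasExpansion_taylor hG (2 * m)
  obtain ⟨δ₃, hδ₃, hΦ⟩ := Metric.eventually_nhds_iff_ball.mp (eventually_Phi_pos hpos)
  set δ := min δ₁ (min δ₂ δ₃)
  have hδ : 0 < δ := by positivity
  have hδ1 : δ ≤ δ₁ := min_le_left _ _
  have hδ2 : δ ≤ δ₂ := (min_le_right _ _).trans (min_le_left _ _)
  have hδ3 : δ ≤ δ₃ := (min_le_right _ _).trans (min_le_right _ _)
  have hg' : HasExpansion δ (fun ε u => G (p + ε • u) / ε ^ (2 * m))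
      (fun k => taylorHom G p (2 * m + k)) := by
    convert hg.anti hδ2 using 4 with ε u
    rw [sum_eq_zero fun j hj => hvan j (mem_range.mp hj) _, sub_zero]
  obtain ⟨C, hC⟩ := exists_abs_integral_sub_gaussAvg_le (neg_pderiv_two_pos hhess)
    (D_eq a b p ▸ hD) hδ (hρ.anti hδ1) hg' (polyGrowth_logCoef a b p)
    (fun k => polyGrowth_taylorHom G p (2 * m + k)) (continuous_logCoef a b p)
    (fun k => continuous_taylorHom G p (2 * m + k)) (logCoef_neg a b p)
    (fun k u => by rw [taylorHom_neg, pow_add, pow_mul]; simp) (fun u => by simp [logCoef])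
    (fun ε h0 _ u hu => hρq ε h0 u (hu.trans_le hδ1))
  obtain ⟨η, C', hη0, hη1, htail⟩ := exists_abs_tail_le ha hmax hint hδ
  rw [← D_eq] at hC
  refine IsBigO.of_bound (C + √(D a b p) / (2 * π) * |C'|) ?_
  filter_upwards [hint, htail, tendsto_norm_mul_geometric hη0 hη1 (m + 2),
    eventually_ge_atTop 1] with N hN htailN hgeo h1N
  have hN1 : (1 : ℝ) ≤ N := by exact_mod_cast h1N
  have hN0 : (0 : ℝ) < N := by linarith
  set ε := (√(N : ℝ))⁻¹ with hε
  have h0 : 0 < ε := by positivity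
  have h1 : ε ≤ 1 := inv_le_one_of_one_le₀ (one_le_sqrt.mpr hN1)
  have hε2 : ε ^ 2 = (N : ℝ)⁻¹ := by rw [hε, inv_pow, sq_sqrt hN0.le]
  have hball : MeasurableSet (Metric.ball p δ) := Metric.isOpen_ball.measurableSet
  set Ψ := {u : ℝ × ℝ | ε * ‖u‖ < δ}.indicator fun u =>
    exp (-peakQuad a b p u + ((F a b (p + ε • u) - F a b p) / ε ^ 2 + peakQuad a b p u)) *
      (G (p + ε • u) / ε ^ (2 * m)) with hΨ
  -- in the ball, `exp (N (F - F(p)))` is `(Φ / Φ(p)) ^ N`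
  have hΨeq : ∀ u, (Metric.ball p δ).indicator (fun q => Phi a b q ^ N * G q) (p + ε • u) =
      Phi a b p ^ N * ε ^ (2 * m) * Ψ u := by
    intro u
    by_cases hu : ε * ‖u‖ < δ
    · have hmem : p + ε • u ∈ Metric.ball p δ := (add_smul_mem_ball h0).mpr hu
      have hΨu : Ψ u = _ := Set.indicator_of_mem (s := {u : ℝ × ℝ | ε * ‖u‖ < δ}) hu _
      have hq := hΦ _ (Metric.ball_subset_ball hδ3 hmem)
      have hexp : exp (-peakQuad a b p u + ((F a b (p + ε • u) - F a b p) / ε ^ 2 +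
          peakQuad a b p u)) = Phi a b (p + ε • u) ^ N / Phi a b p ^ N := by
        rw [← exp_F hq, ← exp_F hpos, ← exp_nat_mul, ← exp_nat_mul, ← exp_sub, hε2]
        congr 1
        field_simp
        ring
      rw [Set.indicator_of_mem hmem, hΨu, hexp]
      field_simp
    · have hmem : p + ε • u ∉ Metric.ball p δ := fun h => hu ((add_smul_mem_ball h0).mp h)
      have hΨu : Ψ u = 0 :=
        Set.indicator_of_notMem (s := {u : ℝ × ℝ | ε * ‖u‖ < δ}) hu _
      rw [Set.indicator_of_notMem hmem, hΨu, mul_zero]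
  have hK : Phi a b p ^ N * ε ^ (2 * m) ≠ 0 := by positivity
  have hΨint : Integrable Ψ := by
    have h := integrable_rescaled (hN.indicator hball) p h0
    simp only [hΨeq] at h
    exact (integrable_const_mul_iff hK.isUnit Ψ).mp h
  have hin : ∫ q in Metric.ball p δ, Phi a b q ^ N * G q =
      (N : ℝ)⁻¹ * (Phi a b p ^ N * ε ^ (2 * m) * ∫ u, Ψ u) := by
    rw [← integral_indicator hball, integral_eq_integral_rescaled _ p h0, hε2]
    simp only [hΨeq]
    rw [integral_const_mul]
  have hmain := hC ε h0 h1 hΨint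
  change |_ * (∫ u, Ψ u) - _| ≤ _ at hmain
  set A := gaussAvg (-pderiv (F a b) p 2 0) (-pderiv (F a b) p 1 1) (-pderiv (F a b) p 0 2)
    (cauchyProd (expCoef (logCoef a b p)) (fun k => taylorHom G p (2 * m + k)) 0) with hA
  set B := gaussAvg (-pderiv (F a b) p 2 0) (-pderiv (F a b) p 1 1) (-pderiv (F a b) p 0 2)
    (cauchyProd (expCoef (logCoef a b p)) (fun k => taylorHom G p (2 * m + k)) 2) with hB
  change ‖I' a b p G N - ((N : ℝ) ^ m)⁻¹ * (A + (N : ℝ)⁻¹ * B)‖ ≤ _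
  set R := ∫ q in (Metric.ball p δ)ᶜ, Phi a b q ^ N * G q
  have hs : √(D a b p) ≠ 0 := (sqrt_pos.mpr hD).ne'
  have hI : I' a b p G N = ε ^ (2 * m) * (√(D a b p) / (2 * π) * ∫ u, Ψ u) +
      √(D a b p) / (2 * π) * (N * (R / Phi a b p ^ N)) := by
    rw [I', I, ← integral_add_compl hball hN, hin, exp_nat_mul, exp_F hpos]
    field_simp
    rfl
  have hεm : ε ^ (2 * m) = ((N : ℝ) ^ m)⁻¹ := by rw [pow_mul, hε2, inv_pow]
  rw [hI, hεm, ← hε2]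
  have hsplit : ((N : ℝ) ^ m)⁻¹ * (√(D a b p) / (2 * π) * ∫ u, Ψ u) +
      √(D a b p) / (2 * π) * (N * (R / Phi a b p ^ N)) -
        ((N : ℝ) ^ m)⁻¹ * (A + ε ^ 2 * B) =
      ((N : ℝ) ^ m)⁻¹ * (√(D a b p) / (2 * π) * (∫ u, Ψ u) - (A + ε ^ 2 * B)) +
      √(D a b p) / (2 * π) * (N * (R / Phi a b p ^ N)) := by ring
  have hR : |R / Phi a b p ^ N| ≤ |C'| * η ^ N := by
    rw [abs_div, abs_of_pos (pow_pos hpos N), div_le_iff₀ (pow_pos hpos N)]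
    refine htailN.trans ?_
    gcongr
    exact le_abs_self C'
  rw [hsplit, Real.norm_eq_abs, Real.norm_of_nonneg (by positivity), add_mul]
  refine (abs_add_le _ _).trans (add_le_add ?_ ?_)
  · rw [abs_mul, abs_of_pos (by positivity)]
    refine (mul_le_mul_of_nonneg_left hmain (by positivity)).trans_eq ?_
    rw [show ε ^ 4 = (ε ^ 2) ^ 2 by ring, hε2, pow_add, mul_inv, inv_pow]
    ring
  · rw [abs_mul, abs_mul, abs_of_nonneg (by positivity), abs_of_pos hN0, mul_assoc]
    refine mul_le_mul_of_nonneg_left ?_ (by positivity)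
    calc (N : ℝ) * |R / Phi a b p ^ N| ≤ N * (|C'| * η ^ N) := by gcongr
      _ = |C'| * (N * η ^ N) := by ring
      _ ≤ _ := by gcongr

/-! ### Gaussian moments and the coefficients -/

lemma peakAvg_monomial {a b : ℝ} {p : ℝ × ℝ} (hhess : (-hess (F a b) p).PosDef) {i j n : ℕ}
    (hij : i + j = 2 * n) :
    peakAvg a b p (fun u => u.1 ^ i * u.2 ^ j) = gau a b p i j / D a b p ^ n := by
  have hD := D_pos hhess
  have e : -hess (F a b) p = !![-pderiv (F a b) p 2 0, -pderiv (F a b) p 1 1;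
      -pderiv (F a b) p 1 1, -pderiv (F a b) p 0 2] := by
    ext i j
    fin_cases i <;> fin_cases j <;> simp [hess]
  have hD' := hD
  rw [D_eq] at hD'
  have h := gaussMoment_smul_inv hD' hij
  rw [← D_eq, ← e] at h
  rw [gau, C, h, peakAvg]
  field_simp

lemma peakAvg_const {a b : ℝ} {p : ℝ × ℝ} (hhess : (-hess (F a b) p).PosDef) (c : ℝ) :
    peakAvg a b p (fun _ => c) = c :=
  gaussAvg_const (neg_pderiv_two_pos hhess) (D_eq a b p ▸ D_pos hhess) c

lemma peakAvg_add {a b : ℝ} {p : ℝ × ℝ} (hhess : (-hess (F a b) p).PosDef) {h k : ℝ × ℝ → ℝ}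
    (hc : Continuous h) (hg : PolyGrowth h) (kc : Continuous k) (kg : PolyGrowth k) :
    peakAvg a b p (fun u => h u + k u) = peakAvg a b p h + peakAvg a b p k :=
  gaussAvg_add (neg_pderiv_two_pos hhess) (D_eq a b p ▸ D_pos hhess) hc hg kc kg

lemma peakAvg_const_mul (a b : ℝ) (p : ℝ × ℝ) (c : ℝ) (h : ℝ × ℝ → ℝ) :
    peakAvg a b p (fun u => c * h u) = c * peakAvg a b p h :=
  gaussAvg_const_mul _ _ _ c h

lemma peakAvg_sum_monomial {a b : ℝ} {p : ℝ × ℝ} (hhess : (-hess (F a b) p).PosDef) {ι : Type*}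
    (s : Finset ι) (c : ι → ℝ) (i j : ι → ℕ) {n : ℕ} (hij : ∀ k ∈ s, i k + j k = 2 * n) :
    peakAvg a b p (fun u => ∑ k ∈ s, c k * (u.1 ^ i k * u.2 ^ j k)) =
      ∑ k ∈ s, c k * (gau a b p (i k) (j k) / D a b p ^ n) := by
  rw [peakAvg, gaussAvg_sum (neg_pderiv_two_pos hhess) (D_eq a b p ▸ D_pos hhess) _
    (fun k _ => by fun_prop)
    (fun k _ => (PolyGrowth.const _).mul (polyGrowth_monomial (i k) (j k)))]
  refine sum_congr rfl fun k hk => ?_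
  rw [gaussAvg_const_mul]
  exact congrArg _ (peakAvg_monomial hhess (hij k hk))

lemma peakAvg_taylorHom {a b : ℝ} {p : ℝ × ℝ} (hhess : (-hess (F a b) p).PosDef)
    (f : ℝ × ℝ → ℝ) {n h : ℕ} (hn : n = 2 * h) :
    peakAvg a b p (taylorHom f p n) =
      ∑ k ∈ antidiagonal n, coef f p k.1 k.2 * (gau a b p k.1 k.2 / D a b p ^ h) :=
  peakAvg_sum_monomial hhess _ (fun k : ℕ × ℕ => coef f p k.1 k.2) (fun k => k.1)
    (fun k => k.2) fun _ hk => (mem_antidiagonal.mp hk).trans hn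

lemma peakAvg_taylorHom_mul {a b : ℝ} {p : ℝ × ℝ} (hhess : (-hess (F a b) p).PosDef)
    (f g : ℝ × ℝ → ℝ) {n m h : ℕ} (hn : n + m = 2 * h) :
    peakAvg a b p (fun u => taylorHom f p n u * taylorHom g p m u) =
      ∑ k ∈ antidiagonal n, ∑ l ∈ antidiagonal m, coef f p k.1 k.2 * coef g p l.1 l.2 *
        (gau a b p (k.1 + l.1) (k.2 + l.2) / D a b p ^ h) := by
  have e : (fun u : ℝ × ℝ => taylorHom f p n u * taylorHom g p m u) = fun u =>
      ∑ x ∈ antidiagonal n ×ˢ antidiagonal m, coef f p x.1.1 x.1.2 * coef g p x.2.1 x.2.2 *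
        (u.1 ^ (x.1.1 + x.2.1) * u.2 ^ (x.1.2 + x.2.2)) := by
    funext u
    rw [taylorHom, taylorHom, sum_mul_sum, sum_product]
    refine sum_congr rfl fun k _ => sum_congr rfl fun l _ => ?_
    rw [pow_add, pow_add]
    ring
  rw [e, peakAvg_sum_monomial hhess _ (fun x : (ℕ × ℕ) × (ℕ × ℕ) =>
      coef f p x.1.1 x.1.2 * coef g p x.2.1 x.2.2)
    (fun x => x.1.1 + x.2.1) (fun x => x.1.2 + x.2.2) (n := h), sum_product]
  intro x hx
  obtain ⟨h1, h2⟩ := mem_product.mp hx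
  rw [HasAntidiagonal.mem_antidiagonal] at h1 h2
  omega

lemma peakAvg_taylorHom_mul_mul {a b : ℝ} {p : ℝ × ℝ} (hhess : (-hess (F a b) p).PosDef)
    (f g q : ℝ × ℝ → ℝ) {n m r h : ℕ} (hn : n + m + r = 2 * h) :
    peakAvg a b p (fun u => taylorHom f p n u * taylorHom g p m u * taylorHom q p r u) =
      ∑ k ∈ antidiagonal n, ∑ l ∈ antidiagonal m, ∑ t ∈ antidiagonal r,
        coef f p k.1 k.2 * coef g p l.1 l.2 * coef q p t.1 t.2 *
        (gau a b p (k.1 + l.1 + t.1) (k.2 + l.2 + t.2) / D a b p ^ h) := by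
  have e : (fun u : ℝ × ℝ => taylorHom f p n u * taylorHom g p m u * taylorHom q p r u) = fun u =>
      ∑ x ∈ antidiagonal n ×ˢ (antidiagonal m ×ˢ antidiagonal r),
        coef f p x.1.1 x.1.2 * coef g p x.2.1.1 x.2.1.2 * coef q p x.2.2.1 x.2.2.2 *
        (u.1 ^ (x.1.1 + x.2.1.1 + x.2.2.1) * u.2 ^ (x.1.2 + x.2.1.2 + x.2.2.2)) := by
    funext u
    rw [mul_assoc, taylorHom, taylorHom, taylorHom, sum_mul_sum (antidiagonal m), ← sum_product',
      sum_mul_sum, sum_product]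
    refine sum_congr rfl fun k _ => sum_congr rfl fun l _ => ?_
    simp only [pow_add]
    ring
  rw [e, peakAvg_sum_monomial hhess _ (fun x : (ℕ × ℕ) × ((ℕ × ℕ) × (ℕ × ℕ)) =>
      coef f p x.1.1 x.1.2 * coef g p x.2.1.1 x.2.1.2 * coef q p x.2.2.1 x.2.2.2)
    (fun x => x.1.1 + x.2.1.1 + x.2.2.1)
    (fun x => x.1.2 + x.2.1.2 + x.2.2.2) (n := h), sum_product]
  · simp only [sum_product]
  intro x hx
  obtain ⟨h1, h2⟩ := mem_product.mp hx
  obtain ⟨h2, h3⟩ := mem_product.mp h2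
  rw [HasAntidiagonal.mem_antidiagonal] at h1 h2 h3
  omega

lemma cauchyProd_expCoef_zero (a b : ℝ) (p : ℝ × ℝ) (d : ℕ → ℝ × ℝ → ℝ) :
    cauchyProd (expCoef (logCoef a b p)) d 0 = d 0 := by
  funext u
  simp [cauchyProd, expCoef, logCoef]

lemma cauchyProd_expCoef_two (a b : ℝ) (p : ℝ × ℝ) (d : ℕ → ℝ × ℝ → ℝ) :
    cauchyProd (expCoef (logCoef a b p)) d 2 = fun u => d 2 u + (taylorHom (F a b) p 3 u * d 1 u +
      (taylorHom (F a b) p 4 u * d 0 u +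
        1 / 2 * (taylorHom (F a b) p 3 u * taylorHom (F a b) p 3 u * d 0 u))) := by
  funext u
  simp [cauchyProd, expCoef, logCoef, Nat.sum_antidiagonal_succ]
  ring

/-- The expectation of the second coefficient of `laplace_expansion`. -/
lemma peakAvg_second {a b : ℝ} {p : ℝ × ℝ} (hhess : (-hess (F a b) p).PosDef) (G : ℝ × ℝ → ℝ)
    (s : ℕ) :
    peakAvg a b p (cauchyProd (expCoef (logCoef a b p)) (fun k => taylorHom G p (s + k)) 2) =
      peakAvg a b p (taylorHom G p (s + 2)) +
      (peakAvg a b p (fun u => taylorHom (F a b) p 3 u * taylorHom G p (s + 1) u) +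
      (peakAvg a b p (fun u => taylorHom (F a b) p 4 u * taylorHom G p s u) +
      1 / 2 * peakAvg a b p (fun u => taylorHom (F a b) p 3 u * taylorHom (F a b) p 3 u *
        taylorHom G p s u))) := by
  have c := continuous_taylorHom
  have g := polyGrowth_taylorHom
  have hc31 : Continuous fun u => taylorHom (F a b) p 3 u * taylorHom G p (s + 1) u :=
    (c (F a b) p 3).mul (c G p (s + 1))
  have hg31 := (g (F a b) p 3).mul (g G p (s + 1))
  have hc40 : Continuous fun u => taylorHom (F a b) p 4 u * taylorHom G p s u :=
    (c (F a b) p 4).mul (c G p s)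
  have hg40 := (g (F a b) p 4).mul (g G p s)
  have hc330 : Continuous fun u => 1 / 2 * (taylorHom (F a b) p 3 u * taylorHom (F a b) p 3 u *
      taylorHom G p s u) :=
    continuous_const (y := (1 / 2 : ℝ)) |>.mul
    (((c (F a b) p 3).mul (c (F a b) p 3)).mul (c G p s))
  have hg330 := (PolyGrowth.const (1 / 2)).mul
    (((g (F a b) p 3).mul (g (F a b) p 3)).mul (g G p s))
  rw [cauchyProd_expCoef_two]
  simp only [Nat.add_zero]
  rw [peakAvg_add hhess (c _ _ _) (g _ _ _) (hc31.fun_add (hc40.fun_add hc330))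
      (hg31.add (hg40.add hg330)),
    peakAvg_add hhess hc31 hg31 (hc40.fun_add hc330) (hg40.add hg330),
    peakAvg_add hhess hc40 hg40 hc330 hg330, peakAvg_const_mul]

lemma taylorHom_one_eq_zero {G : ℝ × ℝ → ℝ} {p : ℝ × ℝ} (hx : pderiv G p 1 0 = 0)
    (hy : pderiv G p 0 1 = 0) (z : ℝ × ℝ) : taylorHom G p 1 z = 0 := by
  simp [taylorHom, Nat.sum_antidiagonal_succ, coef, hx, hy]

/-- The expansion of `I'_N(G)` for arbitrary `G`; it specialises to `G ≡ 1` and to `G(p) = 0`. -/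
theorem laplace_expansion_of_zero {a b : ℝ} (ha : 0 < a) {p : ℝ × ℝ}
    (hmax : IsUniqueGlobalMax (Phi a b) p) (hhess : (-hess (F a b) p).PosDef)
    {G : ℝ × ℝ → ℝ} (hG : AnalyticAt ℝ G p)
    (hint : ∀ᶠ N : ℕ in atTop, Integrable (fun q => Phi a b q ^ N * G q)) :
    (fun N : ℕ => I' a b p G N - (G p + (K a b p G + G p * L a b p) / N))
      =O[atTop] fun N : ℕ => ((N : ℝ) ^ 2)⁻¹ := by
  have h := laplace_expansion ha hmax hhess hG hint 0 (fun j hj => by omega)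
  have e0 : taylorHom G p 0 = fun _ => G p := funext (taylorHom_zero G p)
  have e4 : (fun u => taylorHom (F a b) p 4 u * G p) =
      fun u => G p * taylorHom (F a b) p 4 u := funext fun u => mul_comm _ _
  have e3 : (fun u => taylorHom (F a b) p 3 u * taylorHom (F a b) p 3 u * G p) =
      fun u => G p * (taylorHom (F a b) p 3 u * taylorHom (F a b) p 3 u) :=
    funext fun u => mul_comm _ _
  rw [Nat.mul_zero, cauchyProd_expCoef_zero, peakAvg_second hhess] at h
  simp only [zero_add, e0, e3, e4] at h
  rw [peakAvg_const hhess, peakAvg_const_mul, peakAvg_const_mul,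
    peakAvg_taylorHom hhess G (n := 2) (h := 1) rfl,
    peakAvg_taylorHom_mul hhess (F a b) G (n := 3) (m := 1) (h := 2) rfl,
    peakAvg_taylorHom hhess (F a b) (n := 4) (h := 2) rfl,
    peakAvg_taylorHom_mul hhess (F a b) (F a b) (n := 3) (m := 3) (h := 3) rfl] at h
  refine h.congr_left fun N => ?_
  simp only [K, K1, K2, L, L1, L2, pow_zero, inv_one, one_mul, pow_one]
  ring

end MonomerDimer

theorem proposition3 (a b : ℝ) (ha : 0 < a) (p : ℝ × ℝ)
    (hmax : MonomerDimer.IsUniqueGlobalMax (MonomerDimer.Phi a b) p)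
    (hhess : (-MonomerDimer.hess (MonomerDimer.F a b) p).PosDef) :
    -- a) general `G`
    (∀ G : ℝ × ℝ → ℝ, AnalyticAt ℝ G p →
      (∀ᶠ N : ℕ in atTop, Integrable (fun q => MonomerDimer.Phi a b q ^ N * G q)) →
      (fun N : ℕ => MonomerDimer.I' a b p G N - G p)
        =O[atTop] fun N : ℕ => (N : ℝ)⁻¹) ∧
    -- b) `G ≡ 1`
    ((fun N : ℕ => MonomerDimer.I' a b p (fun _ => 1) N - (1 + MonomerDimer.L a b p / N))
        =O[atTop] fun N : ℕ => ((N : ℝ) ^ 2)⁻¹) ∧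
    -- c) `G` vanishes at the maximum point
    (∀ G : ℝ × ℝ → ℝ, AnalyticAt ℝ G p →
      (∀ᶠ N : ℕ in atTop, Integrable (fun q => MonomerDimer.Phi a b q ^ N * G q)) →
      G p = 0 →
      (fun N : ℕ => MonomerDimer.I' a b p G N - MonomerDimer.K a b p G / N)
        =O[atTop] fun N : ℕ => ((N : ℝ) ^ 2)⁻¹) ∧
    -- d) `G` and its gradient vanish at the maximum point
    (∀ G : ℝ × ℝ → ℝ, AnalyticAt ℝ G p →
      (∀ᶠ N : ℕ in atTop, Integrable (fun q => MonomerDimer.Phi a b q ^ N * G q)) →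
      G p = 0 → MonomerDimer.pderiv G p 1 0 = 0 → MonomerDimer.pderiv G p 0 1 = 0 →
      (fun N : ℕ => MonomerDimer.I' a b p G N -
          (MonomerDimer.K1 a b p G / N + MonomerDimer.M a b p G / (N : ℝ) ^ 2))
        =O[atTop] fun N : ℕ => ((N : ℝ) ^ 3)⁻¹) := by
  refine ⟨fun G hG hint => ?_, ?_, fun G hG hint h0 => ?_, fun G hG hint h0 hx hy => ?_⟩
  · have h := MonomerDimer.laplace_expansion_of_zero ha hmax hhess hG hint
    set c := MonomerDimer.K a b p G + G p * MonomerDimer.L a b p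
    have h1 : (fun N : ℕ => ((N : ℝ) ^ 2)⁻¹) =O[atTop] fun N : ℕ => (N : ℝ)⁻¹ := by
      refine IsBigO.of_bound 1 ?_
      filter_upwards [eventually_ge_atTop 1] with N hN
      have hN1 : (1 : ℝ) ≤ N := by exact_mod_cast hN
      rw [one_mul, Real.norm_of_nonneg (by positivity), Real.norm_of_nonneg (by positivity)]
      exact inv_anti₀ (by positivity) (le_self_pow₀ hN1 two_ne_zero)
    have h2 : (fun N : ℕ => c * (N : ℝ)⁻¹) =O[atTop] fun N : ℕ => (N : ℝ)⁻¹ :=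
      (isBigO_refl _ _).const_mul_left c
    refine ((h.trans h1).add h2).congr_left fun N => ?_
    ring
  · have hint : ∀ᶠ N : ℕ in atTop, Integrable
        (fun q => MonomerDimer.Phi a b q ^ N * (fun _ : ℝ × ℝ => (1 : ℝ)) q) := by
      filter_upwards [eventually_ge_atTop 1] with N hN
      simpa using MonomerDimer.integrable_Phi_pow ha hN
    have h := MonomerDimer.laplace_expansion_of_zero ha hmax hhess analyticAt_const hint
    have hK : MonomerDimer.K a b p (fun _ => 1) = 0 := by
      simp [MonomerDimer.K, MonomerDimer.K1, MonomerDimer.K2, MonomerDimer.coef,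
        MonomerDimer.pderiv, Nat.sum_antidiagonal_succ, iteratedDeriv_const]
    simpa only [hK, zero_add, one_mul] using h
  · have h := MonomerDimer.laplace_expansion_of_zero ha hmax hhess hG hint
    simpa only [h0, zero_mul, add_zero, zero_add] using h
  · have hvan : ∀ j < 2 * 1, ∀ z, MonomerDimer.taylorHom G p j z = 0 := by
      intro j hj z
      interval_cases j
      · rw [MonomerDimer.taylorHom_zero, h0]
      · exact MonomerDimer.taylorHom_one_eq_zero hx hy z
    have h := MonomerDimer.laplace_expansion ha hmax hhess hG hint 1 hvan
    rw [Nat.mul_one, MonomerDimer.cauchyProd_expCoef_zero, MonomerDimer.peakAvg_second hhess,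
      MonomerDimer.peakAvg_taylorHom hhess G (n := 2) (h := 1) rfl,
      MonomerDimer.peakAvg_taylorHom hhess G (n := 2 + 2) (h := 2) rfl,
      MonomerDimer.peakAvg_taylorHom_mul hhess _ G (n := 3) (m := 2 + 1) (h := 3) rfl,
      MonomerDimer.peakAvg_taylorHom_mul hhess _ G (n := 4) (m := 2) (h := 3) rfl,
      MonomerDimer.peakAvg_taylorHom_mul_mul hhess _ _ G (n := 3) (m := 3) (r := 2)
        (h := 4) rfl] at h
    refine h.congr_left fun N => ?_
    simp only [MonomerDimer.K1, MonomerDimer.M, MonomerDimer.M1, MonomerDimer.M2,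
      MonomerDimer.M3, MonomerDimer.M4, pow_one, Nat.reduceAdd]
    ring
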